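/- **Capacity of Byzantine consensus in complete 4-node networks.** *Network.* There are four nodes. The directed link from node $i$ to node $j\ne i$ has capacity $c_{ij}$, a real number of bits per unit time; the network is complete, i.e. $c_{ij}>0$ for all $i\neq j$. *Algorithms.* Each node $i$ holds an input $v_i\in\{0,1\}^{\mathbb N}$, an infinite sequence of bits. A (deterministic, synchronous) algorithm starts at time $0$ and proceeds in rounds, round $k$ occupying a period $[\tau_k,\tau_{k+1}]$, where $0=\tau_0<\tau_1<\cdots\to\infty$; in round $k$ the link from $i$ to $j$ carries a fixed number of bits, at most $(\tau_{k+1}-\tau_k)\,c_{ij}$. What a node sends in round $k$, and the bits of its output array on which it has agreed by time $\tau_k$, are functions of its input and of what it received in earlier rounds. *Faults.* In an execution at most one node is faulty. A faulty node may send arbitrary bits on its outgoing links (with full knowledge of the algorithm, of all inputs and of all states); the other nodes are fault-free and follow the algorithm. *Consensus.* The algorithm solves consensus if, for all inputs and every behaviour of the faulty node: no fault-free node ever changes a bit on which it has agreed; every fault-free node eventually agrees on every bit of its output (termination); the outputs of all fault-free nodes are equal (consistency); and if all fault-free nodes have the same input $v$, their output is $v$ (validity). *Throughput and capacity.* In a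 given execution let $b(t)\in\mathbb N\cup\{\infty\}$ be the largest $b$ such that by time $t$ all fault-free nodes have agreed upon bits $0,\dots,b-1$. The throughput of the execution is $\lim_{t\to\infty} b(t)/t\in[0,\infty]$. A throughput $R$ is achievable if there is an algorithm that solves consensus and for which, in every execution with at most one faulty node, this limit exists and is at least $R$. The capacity $C_{con}$ is the supremum of all achievable throughputs. **Theorem.** For every complete 4-node network with at most one Byzantine fault, every throughput $R<I^*$ is achievable, and $$C_{con}=I^*:=\min\{\,c_{ji}+c_{ki} : i,j,k \text{ pairwise different nodes}\,\},$$ the minimum over all nodes of the sum of the capacities of any two incoming links. -/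

import Mathlib

open Filter Topology
open scoped NNReal ENNReal

namespace ByzantineConsensus

/-- A point-to-point network on the nodes `Fin n`: `cap i j` is the capacity, in bits per unit
time, of the directed link from `i` to `j`. Capacity `0` means that there is no link; in
particular there are no links from a node to itself. -/
structure Network (n : ℕ) where
  cap : Fin n → Fin n → ℝ≥0
  cap_self : ∀ i, cap i i = 0

/-- Every directed link between two different nodes has positive capacity. -/
def Network.IsComplete {n : ℕ} (G : Network n) : Prop :=
  ∀ i j, i ≠ j → 0 < G.cap i j

/-- What node `i` has received in rounds `0, …, k - 1`, where `len j i l` is the number of bits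
that the link from `j` to `i` carries in round `l`. -/
abbrev View {n : ℕ} (len : Fin n → Fin n → ℕ → ℕ) (i : Fin n) (k : ℕ) : Type :=
  (l : Fin k) → (j : Fin n) → Fin (len j i l) → Bool

/-- A (deterministic) synchronous algorithm on the network `G`. It starts at time `0` and round `k`
occupies the period from `time k` to `time (k + 1)`. During that period `len i j k` bits are sent
on the link from `i` to `j`, at most the duration of the period times the capacity of the link.
What a node sends in round `k`, and the bits of its output array on which it has agreed at
time `time k` (`none`: not yet agreed), are functions of its input, an infinite sequence of
bits, and of what it has received in the earlier rounds. -/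
structure Algorithm {n : ℕ} (G : Network n) where
  time : ℕ → ℝ
  time_zero : time 0 = 0
  time_strictMono : StrictMono time
  time_tendsto : Tendsto time atTop atTop
  len : Fin n → Fin n → ℕ → ℕ
  len_le : ∀ i j k, (len i j k : ℝ) ≤ (time (k + 1) - time k) * (G.cap i j : ℝ)
  send : (i j : Fin n) → (k : ℕ) → (ℕ → Bool) → View len i k → Fin (len i j k) → Bool
  output : (i : Fin n) → (k : ℕ) → (ℕ → Bool) → View len i k → ℕ → Option Bool

/-- An execution of the algorithm `A`: the inputs, the set of faulty nodes (those that the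
adversary takes over at some point), and the bits `msg i j k` sent on every link in every round.
The nodes that are not faulty follow the algorithm; the faulty ones send arbitrary bits. -/
structure Execution {n : ℕ} {G : Network n} (A : Algorithm G) where
  input : Fin n → ℕ → Bool
  faulty : Finset (Fin n)
  msg : (i j : Fin n) → (k : ℕ) → Fin (A.len i j k) → Bool
  follows : ∀ i, i ∉ faulty → ∀ j k,
    msg i j k = A.send i j k (input i) (fun l j' => msg j' i l)

namespace Execution

variable {n : ℕ} {G : Network n} {A : Algorithm G} (E : Execution A)

/-- The output array of node `i` at time `A.time k`. -/
def out (i : Fin n) (k : ℕ) : ℕ → Option Bool :=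
  A.output i k (E.input i) (fun l j => E.msg j i l)

/-- The output value of node `i` is the infinite sequence `v`: every bit `v m` is eventually
agreed upon. -/
def Decides (i : Fin n) (v : ℕ → Bool) : Prop :=
  ∀ m, ∃ k, E.out i k m = some (v m)

/-- A bit on which a fault-free node has agreed is never changed. -/
def Irrevocable : Prop :=
  ∀ i, i ∉ E.faulty → ∀ m b k l, k ≤ l → E.out i k m = some b → E.out i l m = some b

/-- Every fault-free node eventually decides on an output value. -/
def Termination : Prop :=
  ∀ i, i ∉ E.faulty → ∃ v, E.Decides i v

/-- The output values of all fault-free nodes are equal. -/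
def Consistency : Prop :=
  ∀ i, i ∉ E.faulty → ∀ j, j ∉ E.faulty → ∀ v w, E.Decides i v → E.Decides j w → v = w

/-- If all fault-free nodes hold the same input, then this is their output value. -/
def Validity : Prop :=
  ∀ v, (∀ i, i ∉ E.faulty → E.input i = v) → ∀ i, i ∉ E.faulty → ∀ w, E.Decides i w → w = v

/-- By time `t` node `i` has agreed on bit number `m`. -/
def AgreedBy (t : ℝ) (i : Fin n) (m : ℕ) : Prop :=
  ∃ k, A.time k ≤ t ∧ (E.out i k m).isSome

/-- `b(t)`: the largest `b` such that by time `t` all fault-free nodes have agreed upon the bits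
`0, …, b - 1`; it is `⊤` if all of them have agreed upon all bits. -/
noncomputable def agreedBits (t : ℝ) : ℕ∞ :=
  ⨆ b ∈ {b : ℕ | ∀ i, i ∉ E.faulty → ∀ m, m < b → E.AgreedBy t i m}, (b : ℕ∞)

/-- The limit of `b(t) / t` as `t → ∞` exists (possibly as `⊤`) and is `r`. -/
def HasThroughput (r : ℝ≥0∞) : Prop :=
  Tendsto (fun t : ℝ => ((E.agreedBits t : ℕ∞) : ℝ≥0∞) / ENNReal.ofReal t) atTop (𝓝 r)

end Execution

/-- The algorithm solves consensus in every execution (for all inputs and any behaviour of the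
adversary) with at most `f` faulty nodes, and the throughput of every such execution is at
least `R`. -/
def Algorithm.Achieves {n : ℕ} {G : Network n} (A : Algorithm G) (f : ℕ) (R : ℝ≥0∞) : Prop :=
  ∀ E : Execution A, E.faulty.card ≤ f →
    E.Irrevocable ∧ E.Termination ∧ E.Consistency ∧ E.Validity ∧
      ∃ r, R ≤ r ∧ E.HasThroughput r

/-- Some algorithm on `G` achieves throughput `R` with at most `f` faulty nodes. -/
def Network.Achievable {n : ℕ} (G : Network n) (f : ℕ) (R : ℝ≥0∞) : Prop :=
  ∃ A : Algorithm G, A.Achieves f R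

/-- The consensus capacity: the supremum of all achievable throughputs. -/
noncomputable def Network.consensusCapacity {n : ℕ} (G : Network n) (f : ℕ) : ℝ≥0∞ :=
  sSup {R | G.Achievable f R}

/-- The triples `(i, j, k)` of pairwise different nodes of a 4-node network. -/
def triples : Finset (Fin 4 × Fin 4 × Fin 4) :=
  Finset.univ.filter fun p => p.2.1 ≠ p.1 ∧ p.2.2 ≠ p.1 ∧ p.2.1 ≠ p.2.2

theorem triples_nonempty : triples.Nonempty := ⟨(0, 1, 2), by decide⟩

/-- The minimum, over the nodes `i` and the pairs of different links `j → i`, `k → i`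
into `i`, of the sum of the capacities of the two links. -/
noncomputable def Network.minTwoIncoming (G : Network 4) : ℝ≥0 :=
  triples.inf' triples_nonempty fun p => G.cap p.2.1 p.1 + G.cap p.2.2 p.1

end ByzantineConsensus

/-! Converse. Silence one link `s → i` into a node `i`; let `i` hold zeros and the other nodes hold
`v`. The two remaining nodes cannot tell whether `s` or `i` is to blame. If `i` is faulty, validity
makes them output `v`; hence if `s` is faulty, consistency makes `i` output `v`, although it learns
about `v` only from its other two links (`senderFaulty_decides`). Counting what these links can
carry bounds the throughput. The time from which the throughput is visible depends on `v`; a Baire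
argument makes it uniform on a dense subset of a cylinder (`exists_cylinder_subset_closure`).

Achievability. Words are Reed-Solomon encoded so that any two links into a node determine them. For
each unit of a slot two sources send symbols of their inputs, the other two nodes decode and send
symbols of the result, and every node compares what it receives with its own word. Fault-free nodes
that see no mismatch among themselves hold the same word (`IsLinkCode.eq_of_enc_eq`). Mismatch flags
are broadcast reliably, and one flagged unit is investigated by broadcasting inputs and received
messages. The public state `(H, C)` records who can still be the faulty node: `C` in general, `H`
under the assumption that all other inputs are equal. The sources are chosen so that a credible flag
always shrinks the state (`PublicState.update_ne`). Hence at most 48 slots are spoiled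
(`card_voidSlot_le`), and their words are broadcast outright at the end. If `H` becomes empty, the
fault-free inputs differ and a default output is legitimate. In long blocks the cost of flags,
investigations and repairs is negligible against that of the code symbols. -/

namespace ByzantineConsensus

/-! ### Converse: indistinguishable runs and counting. -/

section UpperBound

variable {G : Network 4} (A : Algorithm G)

/-- The messages of the run in which every node follows the algorithm, except that the link from
`s` to `i` carries only zeros. -/
def mutedRun (s i : Fin 4) (inp : Fin 4 → ℕ → Bool) (a b : Fin 4) (k : ℕ) :
    Fin (A.len a b k) → Bool :=
  if a = s ∧ b = i then fun _ => false
  else A.send a b k (inp a) (fun l c => mutedRun s i inp c a l)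
termination_by k
decreasing_by exact l.2

/-- The inputs of the muted run: node `i` holds zeros, all other nodes hold `v`. -/
def oddInput (i : Fin 4) (v : ℕ → Bool) (a : Fin 4) : ℕ → Bool :=
  if a = i then fun _ => false else v

/-- The muted run with the sender `s` as the faulty node. -/
def senderFaulty (s i : Fin 4) (v : ℕ → Bool) : Execution A where
  input := oddInput i v
  faulty := {s}
  msg := mutedRun A s i (oddInput i v)
  follows a ha b k := by
    have : a ≠ s := by simpa using ha
    conv_lhs => rw [mutedRun]
    simp [this]

/-- The muted run with the receiver `i` as the faulty node. -/
def receiverFaulty (s i : Fin 4) (v : ℕ → Bool) : Execution A where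
  input := oddInput i v
  faulty := {i}
  msg a b k := if a = s ∧ b = i then
      A.send a b k (oddInput i v a) (fun l c => mutedRun A s i (oddInput i v) c a l)
    else mutedRun A s i (oddInput i v) a b k
  follows a ha b k := by
    have hai : a ≠ i := by simpa using ha
    have : (fun (l : Fin k) c => if c = s ∧ a = i then
      A.send c a l (oddInput i v c) (fun l c' => mutedRun A s i (oddInput i v) c' c l)
      else mutedRun A s i (oddInput i v) c a l) =
        fun (l : Fin k) c => mutedRun A s i (oddInput i v) c a l := by
      funext l c
      simp [hai]
    rw [this]
    split_ifs with h
    · rfl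
    · conv_lhs => rw [mutedRun]
      simp [h]

/-- Node `j` has the same view in `receiverFaulty`, where validity dictates its output, and in
`senderFaulty`, where consistency transfers this output to `i`. -/
theorem senderFaulty_decides {R : ℝ≥0∞} (hA : A.Achieves 1 R) {i j s : Fin 4} (hij : i ≠ j)
    (hsi : s ≠ i) (hsj : s ≠ j) (v : ℕ → Bool) : (senderFaulty A s i v).Decides i v := by
  obtain ⟨-, ht, -, hv, -⟩ := hA (receiverFaulty A s i v) (by simp [receiverFaulty])
  obtain ⟨-, ht', hc, -, -⟩ := hA (senderFaulty A s i v) (by simp [senderFaulty])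
  have hj : j ∉ (receiverFaulty A s i v).faulty := by simpa [receiverFaulty] using hij.symm
  obtain ⟨w, hw⟩ := ht j hj
  have hwv : w = v := hv v (fun a ha => by
    have : a ≠ i := by simpa [receiverFaulty] using ha
    simp [receiverFaulty, oddInput, this]) j hj w hw
  subst hwv
  have hj' : (senderFaulty A s i w).Decides j w := by
    intro m
    obtain ⟨k, hk⟩ := hw m
    refine ⟨k, ?_⟩
    rw [← hk]
    simp [Execution.out, senderFaulty, receiverFaulty, hij.symm]
  have hi : i ∉ (senderFaulty A s i w).faulty := by simpa [senderFaulty] using hsi.symm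
  obtain ⟨w', hw'⟩ := ht' i hi
  have := hc i hi j (by simpa [senderFaulty] using hsj.symm) w' w hw' hj'
  rwa [this] at hw'

theorem senderFaulty_out {R : ℝ≥0∞} (hA : A.Achieves 1 R) {i j s : Fin 4} (hij : i ≠ j)
    (hsi : s ≠ i) (hsj : s ≠ j) (v : ℕ → Bool) {k m : ℕ}
    (h : (senderFaulty A s i v).AgreedBy (A.time k) i m) :
    (senderFaulty A s i v).out i k m = some (v m) := by
  obtain ⟨hirr, -⟩ := hA (senderFaulty A s i v) (by simp [senderFaulty])
  have hi : i ∉ (senderFaulty A s i v).faulty := by simpa [senderFaulty] using hsi.symm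
  obtain ⟨l, hl, hs⟩ := h
  obtain ⟨b, hb⟩ := Option.isSome_iff_exists.1 hs
  obtain ⟨l', hl'⟩ := senderFaulty_decides A hA hij hsi hsj v m
  have h1 := hirr i hi m b l (max l l') (le_max_left _ _) hb
  have h2 := hirr i hi m _ l' (max l l') (le_max_right _ _) hl'
  rw [h1] at h2
  rw [hirr i hi m b l k (A.time_strictMono.le_iff_le.1 hl) hb, h2]

/-- What `i` receives from `j` and `k` in the first `K` rounds. -/
abbrev TwoViews (i j k : Fin 4) (K : ℕ) : Type :=
  (l : Fin K) → (Fin (A.len j i l) → Bool) × (Fin (A.len k i l) → Bool)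

theorem card_twoViews (i j k : Fin 4) (K : ℕ) :
    Fintype.card (TwoViews A i j k K) =
      2 ^ ∑ l ∈ Finset.range K, (A.len j i l + A.len k i l) := by
  rw [← Fin.sum_univ_eq_sum_range (fun l => A.len j i l + A.len k i l)]
  simp [TwoViews, Fintype.card_pi, ← pow_add, Finset.prod_pow_eq_pow_sum]

theorem sum_len_le (i j k : Fin 4) (K : ℕ) :
    ((∑ l ∈ Finset.range K, (A.len j i l + A.len k i l) : ℕ) : ℝ) ≤
      A.time K * ((G.cap j i : ℝ) + G.cap k i) := by
  have h : A.time K = ∑ l ∈ Finset.range K, (A.time (l + 1) - A.time l) := by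
    rw [Finset.sum_range_sub, A.time_zero, sub_zero]
  rw [h, Finset.sum_mul]
  push_cast
  refine Finset.sum_le_sum fun l _ => ?_
  have h1 := A.len_le j i l
  have h2 := A.len_le k i l
  linarith

theorem len_self (i : Fin 4) (k : ℕ) : A.len i i k = 0 := by
  have h := A.len_le i i k
  rw [G.cap_self] at h
  simpa using h

/-- The input of `i` and the link from `s` are constantly zero, so only the links from `j` and `k`
can tell `v` from `w`. -/
theorem senderFaulty_view_eq {i j k s : Fin 4} (hs : ∀ c, c = i ∨ c = j ∨ c = k ∨ c = s)
    (v w : ℕ → Bool) (K : ℕ)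
    (h : (fun l => (mutedRun A s i (oddInput i v) j i l, mutedRun A s i (oddInput i v) k i l) :
        TwoViews A i j k K) =
      fun l : Fin K =>
        (mutedRun A s i (oddInput i w) j i l, mutedRun A s i (oddInput i w) k i l)) (m : ℕ) :
    (senderFaulty A s i v).out i K m = (senderFaulty A s i w).out i K m := by
  have : (fun (l : Fin K) c => mutedRun A s i (oddInput i v) c i l) =
      fun (l : Fin K) c => mutedRun A s i (oddInput i w) c i l := by
    funext l c
    have hl := congrFun h l
    rw [Prod.mk.injEq] at hl
    rcases hs c with rfl | rfl | rfl | rfl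
    · funext b
      exact (Fin.cast (len_self A c l) b).elim0
    · exact hl.1
    · exact hl.2
    · rw [mutedRun, mutedRun]
      simp
  simp only [Execution.out, senderFaulty]
  rw [this]
  simp [oddInput]

/-- Baire category in the Cantor space: the closure of some `F N` has interior, and thus contains a
cylinder. -/
theorem exists_cylinder_subset_closure {F : ℕ → Set (ℕ → Bool)} (hF : ⋃ N, F N = Set.univ) :
    ∃ N L, ∃ v₀ : ℕ → Bool, ∀ v : ℕ → Bool, (∀ m < L, v m = v₀ m) →
      ∀ B, ∃ w ∈ F N, ∀ m < B, w m = v m := by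
  have hcl : ⋃ N, closure (F N) = Set.univ :=
    Set.eq_univ_of_univ_subset (hF ▸ Set.iUnion_mono fun N => subset_closure)
  obtain ⟨N, v₀, hv₀⟩ := nonempty_interior_of_iUnion_of_closed (fun N => isClosed_closure) hcl
  obtain ⟨_, ⟨x, L, rfl⟩, hx, hsub⟩ :=
    (PiNat.isTopologicalBasis_cylinders fun _ : ℕ => Bool).exists_subset_of_mem_open hv₀
      isOpen_interior
  refine ⟨N, L, x, fun v hv B => ?_⟩
  have hvc : v ∈ closure (F N) := interior_subset (hsub hv)
  obtain ⟨w, hw, hwF⟩ := mem_closure_iff.1 hvc _ (PiNat.isOpen_cylinder _ v B)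
    (PiNat.self_mem_cylinder v B)
  exact ⟨w, hwF, hw⟩

theorem agreedBy_of_lt_agreedBits {E : Execution A} {t : ℝ} {m : ℕ}
    (h : (m : ℕ∞) < E.agreedBits t) {i : Fin 4} (hi : i ∉ E.faulty) : E.AgreedBy t i m := by
  simp only [Execution.agreedBits, lt_iSup_iff, Nat.cast_lt, Set.mem_ofPred_eq] at h
  obtain ⟨b, hb, hmb⟩ := h
  exact hb i hi m hmb

/-- An achieved throughput is at most the sum of the capacities of any two links into a node. -/
theorem le_of_achieves {R : ℝ≥0∞} (hA : A.Achieves 1 R) {i j k s : Fin 4} (hij : i ≠ j)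
    (hsi : s ≠ i) (hsj : s ≠ j) (hs : ∀ c, c = i ∨ c = j ∨ c = k ∨ c = s) :
    R ≤ ((G.cap j i + G.cap k i : ℝ≥0) : ℝ≥0∞) := by
  by_contra! hlt
  set c : ℝ≥0 := G.cap j i + G.cap k i with hc
  obtain ⟨R', hcR', hR'⟩ := ENNReal.lt_iff_exists_nnreal_btwn.1 hlt
  rw [ENNReal.coe_lt_coe] at hcR'
  -- Inputs for which the agreed bits outnumber `R' * t` from time `N` on, for a fixed rate `R'`
  -- strictly between the capacity bound and `R`.
  let F : ℕ → Set (ℕ → Bool) := fun N => {v | ∀ t : ℝ, N ≤ t → 0 < t →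
    ENNReal.ofReal (R' * t) < (((senderFaulty A s i v).agreedBits t : ℕ∞) : ℝ≥0∞)}
  have hF : ⋃ N, F N = Set.univ := by
    refine Set.eq_univ_of_forall fun v => Set.mem_iUnion.2 ?_
    obtain ⟨-, -, -, -, r, hr, ht⟩ := hA (senderFaulty A s i v) (by simp [senderFaulty])
    obtain ⟨N, hN⟩ := eventually_atTop.1 (ht.eventually (lt_mem_nhds (hR'.trans_le hr)))
    refine ⟨⌈N⌉₊, fun t ht ht0 => ?_⟩
    have h := hN t ((Nat.le_ceil N).trans ht)
    rw [ENNReal.lt_div_iff_mul_lt (Or.inl (by simpa using ht0)) (Or.inl (by simp))] at h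
    rwa [ENNReal.ofReal_mul (by positivity), ENNReal.ofReal_coe_nnreal]
  obtain ⟨N, L, v₀, hv₀⟩ := exists_cylinder_subset_closure hF
  have hkey : ∀ K : ℕ, (N : ℝ) ≤ A.time K → 0 < A.time K →
      (R' : ℝ) * A.time K - 1 - L ≤ A.time K * c := by
    intro K hK hK0
    set B := ⌊(R' : ℝ) * A.time K⌋₊ with hB
    -- The first `L` bits keep the sequence in the cylinder and the next `B - L` are free. Some
    -- input in `F N` shares its first `B` bits, all of which `i` outputs by round `K`; so different
    -- `w` need different views.
    let ext : (Fin (B - L) → Bool) → ℕ → Bool := fun w m =>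
      if m < L then v₀ m else if h : m - L < B - L then w ⟨m - L, h⟩ else false
    have hext : ∀ w, ∃ v ∈ F N, ∀ m < B, v m = ext w m := fun w =>
      hv₀ (ext w) (fun m hm => by simp [ext, hm]) B
    choose v hvF hv using hext
    have hout : ∀ w m, m < B → (senderFaulty A s i (v w)).out i K m = some (v w m) := by
      intro w m hm
      refine senderFaulty_out A hA hij hsi hsj _ (agreedBy_of_lt_agreedBits A ?_
        (by simpa [senderFaulty] using hsi.symm))
      have h1 := hvF w _ hK hK0
      have h2 : ((m : ℕ∞) : ℝ≥0∞) ≤ ENNReal.ofReal (R' * A.time K) := by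
        rw [ENat.toENNReal_coe]
        refine ENNReal.le_ofReal_iff_toReal_le (by simp) (by positivity) |>.2 ?_
        have := (Nat.cast_le (α := ℝ)).2 hm.le
        simpa using this.trans (Nat.floor_le (by positivity))
      exact ENat.toENNReal_lt.1 (h2.trans_lt h1)
    have hinj : Function.Injective (fun w => (fun l =>
        (mutedRun A s i (oddInput i (v w)) j i l, mutedRun A s i (oddInput i (v w)) k i l) :
        TwoViews A i j k K)) := by
      intro w w' h
      funext ⟨m, hm⟩
      have hmB : m + L < B := by omega
      have h1 := senderFaulty_view_eq A hs _ _ K h (m + L)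
      rw [hout _ _ hmB, hout _ _ hmB, Option.some_inj, hv _ _ hmB, hv _ _ hmB] at h1
      simpa [ext, hm] using h1
    have hcard := Fintype.card_le_of_injective _ hinj
    rw [card_twoViews, Fintype.card_fun, Fintype.card_fin, Fintype.card_bool,
      Nat.pow_le_pow_iff_right (by norm_num)] at hcard
    have h1 := sum_len_le A i j k K
    have h2 : ((B - L : ℕ) : ℝ) ≤ _ := Nat.cast_le.2 hcard
    have h3 : (B : ℝ) ≤ ((B - L : ℕ) : ℝ) + L := by
      exact_mod_cast (by omega : B ≤ B - L + L)
    have h4 := Nat.lt_floor_add_one ((R' : ℝ) * A.time K)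
    have h5 : (c : ℝ) = G.cap j i + G.cap k i := by rw [hc]; push_cast; rfl
    rw [← h5] at h1
    linarith
  have hgap : 0 < (R' : ℝ) - c := sub_pos.2 (by exact_mod_cast hcR')
  obtain ⟨K, hK⟩ := (A.time_tendsto.eventually_gt_atTop
    (max (max N 0) ((1 + L) / ((R' : ℝ) - c)))).exists
  have h1 := hkey K ((le_max_left _ _).trans ((le_max_left _ _).trans hK.le))
    (((le_max_right _ _).trans (le_max_left _ _)).trans_lt hK)
  have h2 := (div_lt_iff₀ hgap).1 ((le_max_right _ _).trans_lt hK)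
  nlinarith

theorem le_minTwoIncoming {R : ℝ≥0∞} (hR : G.Achievable 1 R) : R ≤ (G.minTwoIncoming : ℝ≥0∞) := by
  obtain ⟨A, hA⟩ := hR
  obtain ⟨⟨i, j, k⟩, hp, hmin⟩ := Finset.exists_mem_eq_inf' triples_nonempty
    fun p : Fin 4 × Fin 4 × Fin 4 => G.cap p.2.1 p.1 + G.cap p.2.2 p.1
  rw [Network.minTwoIncoming, hmin]
  have : ∀ i j k : Fin 4, (i, j, k) ∈ triples →
      i ≠ j ∧ ∃ s, s ≠ i ∧ s ≠ j ∧ ∀ c, c = i ∨ c = j ∨ c = k ∨ c = s := by decide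
  obtain ⟨hij, s, hsi, hsj, hs⟩ := this i j k hp
  exact le_of_achieves A hA hij hsi hsj hs

end UpperBound

/-! ### Reed-Solomon codes on the links. -/

section Code

open Polynomial in
theorem coeffs_eq_of_eval_eq {F : Type*} [Field F] {r : ℕ} (x y : Fin r → F) (s : Finset F)
    (hs : r ≤ s.card)
    (h : ∀ z ∈ s, (∑ k, C (x k) * X ^ (k : ℕ) : F[X]).eval z =
      (∑ k, C (y k) * X ^ (k : ℕ) : F[X]).eval z) : x = y := by
  have hdeg : ∀ x : Fin r → F, (∑ k, C (x k) * X ^ (k : ℕ) : F[X]).degree < s.card := fun x =>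
    (degree_sum_fin_lt x).trans_le (by exact_mod_cast hs)
  have hxy := Polynomial.eq_of_degrees_lt_of_eval_finset_eq s (hdeg x) (hdeg y) h
  funext k
  have := congrArg (fun p : F[X] => p.coeff k) hxy
  simpa [finsetSum_coeff, coeff_C_mul, coeff_X_pow, Fin.val_inj] using this

/-- Reed-Solomon codes: words of `r` symbols of `w` bits can be encoded on the links such that any
two links that carry at least `r` symbols together determine the word. -/
theorem exists_linkCode (n : Fin 4 → Fin 4 → ℕ) (r w : ℕ) (hw : ∑ a, ∑ b, n a b ≤ 2 ^ w)
    (hw0 : w ≠ 0) :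
    ∃ enc : ∀ a b, (Fin r → Fin w → Bool) → (Fin (n a b) → Fin w → Bool),
      ∀ a b a' b', (a, b) ≠ (a', b') → r ≤ n a b + n a' b' →
        ∀ x y, enc a b x = enc a b y → enc a' b' x = enc a' b' y → x = y := by
  let F := GaloisField 2 w
  have : Fintype F := Fintype.ofFinite F
  have hF : Fintype.card F = 2 ^ w := by
    rw [Fintype.card_eq_nat_card, GaloisField.card 2 w hw0]
  obtain ⟨φ⟩ : Nonempty (F ≃ (Fin w → Bool)) := Fintype.card_eq.1 (by simp [hF])
  -- All symbols on all links get different evaluation points, so the symbols of two links are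
  -- values of one polynomial of degree below `r` at distinct points.
  obtain ⟨pt⟩ : Nonempty ((Σ ab : Fin 4 × Fin 4, Fin (n ab.1 ab.2)) ↪ F) :=
    Function.Embedding.nonempty_of_card_le (by simpa [hF, Fintype.sum_prod_type] using hw)
  refine ⟨fun a b x c => φ ((∑ k, Polynomial.C (φ.symm (x k)) * Polynomial.X ^ (k : ℕ) :
    Polynomial F).eval (pt ⟨(a, b), c⟩)), fun a b a' b' hne hr x y h h' => ?_⟩
  let ι : Fin (n a b) ⊕ Fin (n a' b') ↪ F := ⟨Sum.elim (fun c => pt ⟨(a, b), c⟩)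
    (fun c => pt ⟨(a', b'), c⟩), by
      rintro (c | c) (d | d) hcd
      · simpa using hcd
      · exact absurd (congrArg Sigma.fst (pt.injective hcd)) hne
      · exact absurd (congrArg Sigma.fst (pt.injective hcd)) hne.symm
      · simpa using hcd⟩
  have := coeffs_eq_of_eval_eq (fun k => φ.symm (x k)) (fun k => φ.symm (y k))
    (Finset.univ.map ι) (by simpa using hr) (by
      intro z hz
      obtain ⟨c | c, -, rfl⟩ := Finset.mem_map.1 hz
      · exact φ.injective (congrFun h c)
      · exact φ.injective (congrFun h' c))
  funext k
  exact φ.symm.injective (congrFun this k)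

variable {X : Type} {M : Fin 4 → Fin 4 → Type}

/-- Any two links into a node determine the word, and so do the two links between some pair of
nodes of each triple. -/
structure IsLinkCode (enc : ∀ a b, X → M a b) : Prop where
  incoming : ∀ p q a, p ≠ q → p ≠ a → q ≠ a →
    ∀ x y, enc p a x = enc p a y → enc q a x = enc q a y → x = y
  triple : ∀ i j k : Fin 4, i ≠ j → i ≠ k → j ≠ k →
    (∀ x y, enc i j x = enc i j y → enc j i x = enc j i y → x = y) ∨
    (∀ x y, enc i k x = enc i k y → enc k i x = enc k i y → x = y) ∨
    (∀ x y, enc j k x = enc j k y → enc k j x = enc k j y → x = y)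

/-- For the triple condition, add `hr` for the three nodes: the six links within a triple carry at
least `3 * r` symbols, so the two links between some pair carry at least `r`. -/
theorem exists_isLinkCode (n : Fin 4 → Fin 4 → ℕ) (r w : ℕ) (hw : ∑ a, ∑ b, n a b ≤ 2 ^ w)
    (hw0 : w ≠ 0) (hr : ∀ p q a, p ≠ q → p ≠ a → q ≠ a → r ≤ n p a + n q a) :
    ∃ enc : ∀ a b, (Fin r → Fin w → Bool) → (Fin (n a b) → Fin w → Bool), IsLinkCode enc := by
  obtain ⟨enc, henc⟩ := exists_linkCode n r w hw hw0
  refine ⟨enc, fun p q a hpq hpa hqa => henc p a q a (by simpa using hpq) (hr p q a hpq hpa hqa),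
    fun i j k hij hik hjk => ?_⟩
  have h1 := hr j k i hjk hij.symm hik.symm
  have h2 := hr i k j hik hij hjk.symm
  have h3 := hr i j k hij hik hjk
  by_cases h : r ≤ n i j + n j i
  · exact .inl (henc _ _ _ _ (by simp [hij]) h)
  by_cases h' : r ≤ n i k + n k i
  · exact .inr (.inl (henc _ _ _ _ (by simp [hik]) h'))
  · exact .inr (.inr (henc _ _ _ _ (by simp [hjk]) (by omega)))

/-- Among the three nodes other than `f`, some pair has equal words by the triple condition. The
third node then sees symbols of this one word on both links from the pair, so its word is the same.
-/
theorem IsLinkCode.eq_of_enc_eq {enc : ∀ a b, X → M a b} (h : IsLinkCode enc) {v : Fin 4 → X}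
    {f : Fin 4} (hv : ∀ a b, a ≠ f → b ≠ f → a ≠ b → enc a b (v a) = enc a b (v b)) {a b : Fin 4}
    (ha : a ≠ f) (hb : b ≠ f) : v a = v b := by
  have step : ∀ i j k, i ≠ j → i ≠ k → j ≠ k → i ≠ f → j ≠ f → k ≠ f → v i = v j → v i = v k := by
    intro i j k hij hik hjk hi hj hk hvij
    refine h.incoming i j k hij hik hjk _ _ (hv i k hi hk hik) ?_
    rw [hvij]
    exact hv j k hj hk hjk
  have key : ∀ i j k, i ≠ j → i ≠ k → j ≠ k → i ≠ f → j ≠ f → k ≠ f →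
      v i = v j ∧ v i = v k := by
    intro i j k hij hik hjk hi hj hk
    rcases h.triple i j k hij hik hjk with H | H | H
    · have := H (v i) (v j) (hv i j hi hj hij) (hv j i hj hi hij.symm).symm
      exact ⟨this, step i j k hij hik hjk hi hj hk this⟩
    · have := H (v i) (v k) (hv i k hi hk hik) (hv k i hk hi hik.symm).symm
      exact ⟨step i k j hik hij hjk.symm hi hk hj this, this⟩
    · have := H (v j) (v k) (hv j k hj hk hjk) (hv k j hk hj hjk.symm).symm
      have h' := step j k i hjk hij.symm hik.symm hj hk hi this
      exact ⟨h'.symm, h'.symm.trans this⟩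
  by_cases hab : a = b
  · rw [hab]
  have : ∀ f a b : Fin 4, a ≠ f → b ≠ f → a ≠ b → ∃ c, c ≠ f ∧ a ≠ c ∧ b ≠ c := by decide
  obtain ⟨c, hc, hac, hbc⟩ := this f a b ha hb hab
  exact (key a b c hab hac hbc ha hb hc).1

/-- Recovers a word from the symbols on the two links `p → a` and `q → a`. -/
noncomputable def decodeWord [Inhabited X] (enc : ∀ a b, X → M a b) (p q a : Fin 4)
    (mp : M p a) (mq : M q a) : X :=
  open Classical in if h : ∃ x, enc p a x = mp ∧ enc q a x = mq then h.choose else default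

theorem decodeWord_enc [Inhabited X] {enc : ∀ a b, X → M a b} (h : IsLinkCode enc) {p q a : Fin 4}
    (hpq : p ≠ q) (hpa : p ≠ a) (hqa : q ≠ a) (x : X) :
    decodeWord enc p q a (enc p a x) (enc q a x) = x := by
  have hx : ∃ y, enc p a y = enc p a x ∧ enc q a y = enc q a x := ⟨x, rfl, rfl⟩
  rw [decodeWord, dif_pos hx]
  exact h.incoming p q a hpq hpa hqa _ _ hx.choose_spec.1 hx.choose_spec.2

end Code

/-! ### The public state: suspects, source selection and void slots. -/

section State

variable {X : Type} [Inhabited X] {M : Fin 4 → Fin 4 → Type}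

/-- The public state `(H, C)` of a generation. The faulty node belongs to `C`, and to `H` if all
other nodes hold the same input. -/
abbrev PublicState : Type := Finset (Fin 4) × Finset (Fin 4)

/-- Suitable choices of two sources, whose words the other two nodes decode. -/
def PublicState.GoodSources (σ : PublicState) (p q : Fin 4) : Prop :=
  p ≠ q ∧ (∃ h ∈ σ.1, p ≠ h ∧ q ≠ h) ∧ ((p ∈ σ.2 ∧ q ∈ σ.2) ∨ (p ∉ σ.2 ∧ q ∉ σ.2))

/-- Fix `h` in `H`, hence in `C`. If `C` has at least three elements, two of them differ from `h`;
otherwise the complement of `C` has two elements, and `h` is not among them. -/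
theorem PublicState.exists_goodSources (σ : PublicState) (h : σ.1.Nonempty) (hs : σ.1 ⊆ σ.2) :
    ∃ p q, σ.GoodSources p q := by
  have : ∀ C : Finset (Fin 4), ∀ h ∈ C, ∃ p q : Fin 4, p ≠ q ∧ (p ≠ h ∧ q ≠ h) ∧
      ((p ∈ C ∧ q ∈ C) ∨ (p ∉ C ∧ q ∉ C)) := by decide
  obtain ⟨h, hh⟩ := h
  obtain ⟨p, q, h1, h2, h3⟩ := this σ.2 h (hs hh)
  exact ⟨p, q, h1, ⟨h, hh, h2⟩, h3⟩

open scoped Classical in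
/-- The two sources in the state `σ`. -/
noncomputable def PublicState.sources (σ : PublicState) : Fin 4 × Fin 4 :=
  if h : ∃ pq : Fin 4 × Fin 4, σ.GoodSources pq.1 pq.2 then h.choose else (0, 1)

theorem PublicState.sources_ne (σ : PublicState) : σ.sources.1 ≠ σ.sources.2 := by
  unfold sources
  split_ifs with h
  · exact h.choose_spec.1
  · decide

theorem PublicState.goodSources (σ : PublicState) (h : σ.1.Nonempty) (hs : σ.1 ⊆ σ.2) :
    σ.GoodSources σ.sources.1 σ.sources.2 := by
  obtain ⟨p, q, hpq⟩ := σ.exists_goodSources h hs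
  have : ∃ pq : Fin 4 × Fin 4, σ.GoodSources pq.1 pq.2 := ⟨(p, q), hpq⟩
  rw [sources, dif_pos this]
  exact this.choose_spec

def PublicState.IsSource (σ : PublicState) (a : Fin 4) : Prop :=
  a = σ.sources.1 ∨ a = σ.sources.2

theorem PublicState.isSource_fst (σ : PublicState) : σ.IsSource σ.sources.1 := .inl rfl

theorem PublicState.isSource_snd (σ : PublicState) : σ.IsSource σ.sources.2 := .inr rfl

/-- The link between `a` and `b` is checked if both of them may be fault-free. -/
def PublicState.Checked (σ : PublicState) (a b : Fin 4) : Prop :=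
  ∃ w ∈ σ.2, w ≠ a ∧ w ≠ b

variable (enc : ∀ a b, X → M a b)

open scoped Classical in
/-- The word that node `b` adopts: its input `x` if it is a source, and otherwise what it decodes
from the messages `m` of the sources. -/
noncomputable def nodeWord (σ : PublicState) (b : Fin 4) (x : X) (m : ∀ a, M a b) : X :=
  if σ.IsSource b then x
  else decodeWord enc σ.sources.1 σ.sources.2 b (m σ.sources.1) (m σ.sources.2)

/-- Some message to `b` on a checked link does not fit the word of `b`. -/
def Mismatch (σ : PublicState) (b : Fin 4) (x : X) (m : ∀ a, M a b) : Prop :=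
  ∃ a, a ≠ b ∧ σ.Checked a b ∧ m a ≠ enc a b (nodeWord enc σ b x m)

/-- The claimed inputs `x`, received messages `m` and mismatch flags are consistent with `w` being
the faulty node. -/
def ConsistentWith (σ : PublicState) (x : Fin 4 → X) (m : ∀ b a, M a b) (flag : Fin 4 → Bool)
    (w : Fin 4) : Prop :=
  ∀ b, b ≠ w → (∀ a, a ≠ w → a ≠ b → m b a = enc a b (nodeWord enc σ a (x a) (m a))) ∧
    (flag b = true ↔ Mismatch enc σ b (x b) (m b))

open scoped Classical in
/-- The state after the claims about a unit that was processed in the state `ρ`. -/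
noncomputable def PublicState.update (ρ σ : PublicState) (x : Fin 4 → X) (m : ∀ b a, M a b)
    (flag : Fin 4 → Bool) : PublicState :=
  (σ.1.filter fun w => ConsistentWith enc ρ x m flag w ∧ ∀ a b, a ≠ w → b ≠ w → x a = x b,
    σ.2.filter fun w => ConsistentWith enc ρ x m flag w)

variable {enc} in
theorem PublicState.mem_update_fst {ρ σ : PublicState} {x : Fin 4 → X} {m : ∀ b a, M a b}
    {flag : Fin 4 → Bool} {w : Fin 4} : w ∈ (ρ.update enc σ x m flag).1 ↔
      w ∈ σ.1 ∧ ConsistentWith enc ρ x m flag w ∧ ∀ a b, a ≠ w → b ≠ w → x a = x b := by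
  classical
  simp only [update, Finset.mem_filter]

variable {enc} in
theorem PublicState.mem_update_snd {ρ σ : PublicState} {x : Fin 4 → X} {m : ∀ b a, M a b}
    {flag : Fin 4 → Bool} {w : Fin 4} : w ∈ (ρ.update enc σ x m flag).2 ↔
      w ∈ σ.2 ∧ ConsistentWith enc ρ x m flag w := by
  classical
  simp only [update, Finset.mem_filter]

-- If nothing shrank, every suspect in `C` would be consistent with the claims, and a suspect in `H`
-- other than both sources would force equal claims of the sources. Then the nodes at both ends of
-- the flagged link would hold this common word, and there would be no mismatch.
variable {enc} in
theorem PublicState.update_ne (henc : IsLinkCode enc) {σ : PublicState} (h : σ.1.Nonempty)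
    (hs : σ.1 ⊆ σ.2) {x : Fin 4 → X} {m : ∀ b a, M a b} {flag : Fin 4 → Bool} {b : Fin 4}
    (hb : flag b = true) (hw : ∃ w ∈ σ.2, w ≠ b) : σ.update enc σ x m flag ≠ σ := by
  intro heq
  have hH : ∀ w ∈ σ.1, ∀ a b, a ≠ w → b ≠ w → x a = x b := by
    intro w hw
    rw [← heq, mem_update_fst] at hw
    exact hw.2.2
  have hC : ∀ w ∈ σ.2, ConsistentWith enc σ x m flag w := by
    intro w hw
    rw [← heq, mem_update_snd] at hw
    exact hw.2
  obtain ⟨hpq, ⟨g, hg, hpg, hqg⟩, hpqC⟩ := σ.goodSources h hs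
  have hx := hH g hg _ _ hpg hqg
  obtain ⟨w, hw, hwb⟩ := hw
  obtain ⟨a, hab, ⟨w', hw', hwa', hwb'⟩, hne⟩ := (hC w hw b hwb.symm).2.1 hb
  rw [(hC w' hw' b hwb'.symm).1 a hwa'.symm hab] at hne
  have key : ∀ c, (¬ σ.IsSource c → m c σ.sources.1 = enc σ.sources.1 c (x σ.sources.1) ∧
      m c σ.sources.2 = enc σ.sources.2 c (x σ.sources.2)) →
      nodeWord enc σ c (x c) (m c) = x σ.sources.1 := by
    intro c hc
    unfold nodeWord
    split_ifs with hsrc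
    · rcases hsrc with rfl | rfl
      · rfl
      · exact hx.symm
    · obtain ⟨h1, h2⟩ := hc hsrc
      rw [IsSource, not_or] at hsrc
      rw [h1, h2, ← hx]
      exact decodeWord_enc henc hpq (Ne.symm hsrc.1) (Ne.symm hsrc.2) _
  have hsrcWord : ∀ w c d, ConsistentWith enc σ x m flag w → c ≠ w → d ≠ w → d ≠ c →
      σ.IsSource d → m c d = enc d c (x d) := by
    intro w c d hcons hc hd hdc hsd
    rw [(hcons c hc).1 d hd hdc, nodeWord, if_pos hsd]
  -- If both sources are suspects, suspecting either one vouches for the messages of the other. If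
  -- neither is, the suspect `w'` away from the flagged link vouches for both.
  rcases hpqC with ⟨hp, hq⟩ | ⟨hp, hq⟩
  · have hall : ∀ c, nodeWord enc σ c (x c) (m c) = x σ.sources.1 := by
      intro c
      refine key c fun hsrc => ?_
      rw [IsSource, not_or] at hsrc
      exact ⟨hsrcWord _ _ _ (hC _ hq) hsrc.2 hpq (Ne.symm hsrc.1) (.inl rfl),
        hsrcWord _ _ _ (hC _ hp) hsrc.1 hpq.symm (Ne.symm hsrc.2) (.inr rfl)⟩
    rw [hall, hall] at hne
    exact hne rfl
  · have hall : ∀ c, w' ≠ c → nodeWord enc σ c (x c) (m c) = x σ.sources.1 := by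
      intro c hc
      refine key c fun hsrc => ?_
      rw [IsSource, not_or] at hsrc
      exact ⟨hsrcWord _ _ _ (hC _ hw') hc.symm (fun h => hp (h ▸ hw')) (Ne.symm hsrc.1) (.inl rfl),
        hsrcWord _ _ _ (hC _ hw') hc.symm (fun h => hq (h ▸ hw')) (Ne.symm hsrc.2) (.inr rfl)⟩
    rw [hall _ hwa', hall _ hwb'] at hne
    exact hne rfl

variable {N : ℕ}

/-- What node `b` broadcasts in a round: mismatch flags, a word and received messages. -/
abbrev Payload (X : Type) (M : Fin 4 → Fin 4 → Type) (N : ℕ) (b : Fin 4) : Type :=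
  (Fin N → Bool) × X × (∀ a, M a b)

/-- Unit `u` of slot `s` has been flagged by a node that may be fault-free. -/
def Flagged (pub : ℕ → ∀ b, Payload X M N b) (σ : PublicState) (s : ℕ) (u : Fin N) : Prop :=
  ∃ b, (∃ w ∈ σ.2, w ≠ b) ∧ (pub (s + 2) b).1 u = true

variable [NeZero N]

open scoped Classical in
/-- The unit of slot `s` that is investigated. -/
noncomputable def flaggedUnit (pub : ℕ → ∀ b, Payload X M N b) (σ : PublicState) (s : ℕ) :
    Fin N :=
  if h : ∃ u, Flagged pub σ s u then h.choose else 0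

omit [Inhabited X] in
theorem flagged_flaggedUnit {pub : ℕ → ∀ b, Payload X M N b} {σ : PublicState} {s : ℕ}
    (h : ∃ u, Flagged pub σ s u) : Flagged pub σ s (flaggedUnit pub σ s) := by
  rw [flaggedUnit, dif_pos h]
  exact h.choose_spec

omit [Inhabited X] [NeZero N] in
theorem flagged_congr {pub pub' : ℕ → ∀ b, Payload X M N b} (σ : PublicState) (s : ℕ)
    (h : pub (s + 2) = pub' (s + 2)) : Flagged pub σ s = Flagged pub' σ s := by
  unfold Flagged
  rw [h]

omit [Inhabited X] in
theorem flaggedUnit_congr {pub pub' : ℕ → ∀ b, Payload X M N b} (σ : PublicState) (s : ℕ)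
    (h : pub (s + 2) = pub' (s + 2)) : flaggedUnit pub σ s = flaggedUnit pub' σ s := by
  unfold flaggedUnit
  rw [flagged_congr σ s h]

variable (S : ℕ) (pub : ℕ → ∀ b, Payload X M N b)

open scoped Classical in
/-- The public state in round `t`. The flags for slot `s` are broadcast in round `s + 2`, the
claims about the investigated unit in round `s + 4`, and they take effect in round `s + 6`. -/
noncomputable def publicState : ℕ → PublicState
  | 0 => (Finset.univ, Finset.univ)
  | t + 1 =>
    -- Slot `t - 5` is investigated only if its two sending rounds used the same state; otherwise
    -- honest nodes could look inconsistent.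
    if 5 ≤ t ∧ t - 5 < S ∧ publicState (t - 5) = publicState (t - 4) ∧
        ∃ u, Flagged pub (publicState (t - 5)) (t - 5) u then
      (publicState (t - 5)).update enc (publicState t) (fun b => (pub (t - 5 + 4) b).2.1)
        (fun b => (pub (t - 5 + 4) b).2.2)
        (fun b => (pub (t - 5 + 2) b).1 (flaggedUnit pub (publicState (t - 5)) (t - 5)))
    else publicState t
decreasing_by all_goals omega

theorem publicState_add_six (s : ℕ) (hs : s < S)
    (h : publicState enc S pub s = publicState enc S pub (s + 1))
    (hf : ∃ u, Flagged pub (publicState enc S pub s) s u) :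
    publicState enc S pub (s + 6) = (publicState enc S pub s).update enc
      (publicState enc S pub (s + 5)) (fun b => (pub (s + 4) b).2.1)
        (fun b => (pub (s + 4) b).2.2)
        (fun b => (pub (s + 2) b).1 (flaggedUnit pub (publicState enc S pub s) s)) := by
  rw [publicState]
  have h1 : s + 5 - 5 = s := by omega
  have h2 : s + 5 - 4 = s + 1 := by omega
  rw [h1, h2, if_pos ⟨by omega, hs, h, hf⟩]

theorem publicState_succ (t : ℕ) :
    publicState enc S pub (t + 1) = publicState enc S pub t ∨
    ∃ s, t = s + 5 ∧ s < S ∧ publicState enc S pub s = publicState enc S pub (s + 1) ∧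
      (∃ u, Flagged pub (publicState enc S pub s) s u) := by
  rw [publicState]
  split_ifs with h
  · refine .inr ⟨t - 5, by omega, h.2.1, ?_, h.2.2.2⟩
    rw [h.2.2.1]
    congr 1
    omega
  · exact .inl rfl

theorem publicState_induction {motive : PublicState → Prop}
    (init : motive (Finset.univ, Finset.univ))
    (step : ∀ s, s < S → publicState enc S pub s = publicState enc S pub (s + 1) →
      (∃ u, Flagged pub (publicState enc S pub s) s u) → motive (publicState enc S pub (s + 5)) →
      motive ((publicState enc S pub s).update enc
        (publicState enc S pub (s + 5)) (fun b => (pub (s + 4) b).2.1)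
        (fun b => (pub (s + 4) b).2.2)
        (fun b => (pub (s + 2) b).1 (flaggedUnit pub (publicState enc S pub s) s))))
    (t : ℕ) : motive (publicState enc S pub t) := by
  induction t with
  | zero => rw [publicState]; exact init
  | succ t ih =>
    rcases publicState_succ enc S pub t with h | ⟨s, rfl, hs, h, hf⟩
    · rw [h]; exact ih
    · rw [publicState_add_six enc S pub s hs h hf]
      exact step s hs h hf ih

/-- Causality: a broadcast takes two rounds, sending and relaying. -/
theorem publicState_congr {pub pub' : ℕ → ∀ b, Payload X M N b} (t : ℕ)
    (h : ∀ l, l + 2 ≤ t → pub l = pub' l) :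
    publicState enc S pub t = publicState enc S pub' t := by
  induction t using Nat.strong_induction_on with
  | _ t ih =>
    cases t with
    | zero => rw [publicState, publicState]
    | succ t =>
      rw [publicState, publicState]
      rw [← ih (t - 5) (by omega) fun l hl => h l (by omega),
        ← ih (t - 4) (by omega) fun l hl => h l (by omega),
        ← ih t (by omega) fun l hl => h l (by omega)]
      by_cases h5 : 5 ≤ t
      · have e2 := h (t - 5 + 2) (by omega)
        have e4 := h (t - 5 + 4) (by omega)
        rw [flaggedUnit_congr _ _ e2, flagged_congr _ _ e2, e2, e4]
      · simp [h5]

theorem publicState_fst_subset_snd (t : ℕ) :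
    (publicState enc S pub t).1 ⊆ (publicState enc S pub t).2 := by
  refine publicState_induction enc S pub (motive := fun σ => σ.1 ⊆ σ.2) (by simp) ?_ t
  intro s _ _ _ ih w hw
  rw [PublicState.mem_update_fst] at hw
  rw [PublicState.mem_update_snd]
  exact ⟨ih hw.1, hw.2.1⟩

theorem publicState_antitone : Antitone (publicState enc S pub) := by
  refine antitone_nat_of_succ_le fun t => ?_
  rcases publicState_succ enc S pub t with h | ⟨s, rfl, hs, h, hf⟩
  · exact h.le
  · rw [publicState_add_six enc S pub s hs h hf]
    exact ⟨fun w hw => (PublicState.mem_update_fst.1 hw).1,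
      fun w hw => (PublicState.mem_update_snd.1 hw).1⟩

theorem publicState_eq_of_le {s i : ℕ} (hi : i ≤ 6)
    (h : publicState enc S pub s = publicState enc S pub (s + 6)) :
    publicState enc S pub (s + i) = publicState enc S pub s :=
  le_antisymm (publicState_antitone enc S pub (by omega))
    (h.le.trans (publicState_antitone enc S pub (by omega)))

-- A flag would trigger an update, which by `PublicState.update_ne` changes the state before round
-- `s + 6`, or in that round.
variable {enc} in
theorem not_flagged_of_publicState_eq (henc : IsLinkCode enc) {s : ℕ} (hs : s < S)
    (h : publicState enc S pub s = publicState enc S pub (s + 6))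
    (hH : (publicState enc S pub s).1.Nonempty) (u : Fin N) :
    ¬ Flagged pub (publicState enc S pub s) s u := by
  intro hu
  have hf : ∃ u, Flagged pub (publicState enc S pub s) s u := ⟨u, hu⟩
  have h6 := publicState_add_six enc S pub s hs
    (publicState_eq_of_le enc S pub (by norm_num) h).symm hf
  rw [publicState_eq_of_le enc S pub (by norm_num : 5 ≤ 6) h, ← h] at h6
  obtain ⟨b, hw, hb⟩ := flagged_flaggedUnit hf
  exact PublicState.update_ne henc hH (publicState_fst_subset_snd enc S pub s) hb hw h6.symm

/-- Slot `s` is void if the state changes while it is processed. -/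
def VoidSlot (s : ℕ) : Prop :=
  publicState enc S pub s ≠ publicState enc S pub (s + 6)

-- The potential `|H| + |C|` starts at 8, never increases, and drops between `s` and `s + 6` for
-- each void slot. Summing these drops telescopes to six boundary terms of at most 8 each.
open scoped Classical in
theorem card_voidSlot_le :
    ((Finset.range S).filter fun s => VoidSlot enc S pub s).card ≤ 48 := by
  let Φ : ℕ → ℕ := fun t => (publicState enc S pub t).1.card + (publicState enc S pub t).2.card
  have hΦ : ∀ t, Φ t ≤ 8 := fun t =>
    add_le_add (card_finset_fin_le (publicState enc S pub t).1)
      (card_finset_fin_le (publicState enc S pub t).2)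
  have hstep : ∀ s, (if VoidSlot enc S pub s then 1 else 0) + Φ (s + 6) ≤ Φ s := by
    intro s
    have hle := publicState_antitone enc S pub (by omega : s ≤ s + 6)
    have h1 := Finset.card_le_card hle.1
    have h2 := Finset.card_le_card hle.2
    split_ifs with hv
    · by_contra! hlt
      simp only [Φ] at hlt
      exact hv (Prod.ext (Finset.eq_of_subset_of_card_le hle.1 (by omega)).symm
        (Finset.eq_of_subset_of_card_le hle.2 (by omega)).symm)
    · simp only [Φ]
      omega
  have hsum : ∀ T, ∑ s ∈ Finset.range T, (if VoidSlot enc S pub s then 1 else 0) +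
      ∑ i ∈ Finset.range 6, Φ (T + i) ≤ 48 := by
    intro T
    induction T with
    | zero =>
      simp only [Finset.sum_range_succ, Finset.sum_range_zero]
      have := hΦ 0; have := hΦ 1; have := hΦ 2; have := hΦ 3; have := hΦ 4; have := hΦ 5
      simp only [zero_add] at *
      omega
    | succ T ih =>
      have := hstep T
      rw [Finset.sum_range_succ]
      simp only [Finset.sum_range_succ, Finset.sum_range_zero, Nat.add_zero, add_assoc,
        Nat.reduceAdd] at *
      omega
  rw [Finset.card_filter]
  exact (Nat.le_add_right _ _).trans (hsum S)

/-- Position `z` of the concatenation of all slots belongs to a void slot. -/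
def VoidPos (z : ℕ) : Prop := z < S * N ∧ VoidSlot enc S pub (z / N)

open scoped Classical in
theorem count_voidPos_lt {z : ℕ} (hz : VoidPos enc S pub z) :
    Nat.count (VoidPos enc S pub) z < 48 * N := by
  have h1 : Nat.count (VoidPos enc S pub) z < Nat.count (VoidPos enc S pub) (S * N) :=
    Nat.count_strict_mono hz hz.1
  refine h1.trans_le ?_
  rw [Nat.count_eq_card_filter_range]
  refine (Finset.card_le_mul_card_image_of_maps_to (f := fun z => z / N)
    (t := (Finset.range S).filter fun s => VoidSlot enc S pub s) ?_ N ?_).trans ?_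
  · intro y hy
    simp only [Finset.mem_filter, Finset.mem_range] at hy ⊢
    exact ⟨Nat.div_lt_of_lt_mul (by rw [mul_comm]; exact hy.1), hy.2.2⟩
  · intro s _
    refine (Finset.card_le_card (t := Finset.Ico (s * N) (s * N + N)) ?_).trans (by simp)
    intro y hy
    simp only [Finset.mem_filter, Finset.mem_Ico] at hy ⊢
    have := Nat.div_add_mod y N
    have hlt := Nat.mod_lt y (Nat.pos_of_neZero N)
    rw [hy.2, mul_comm] at this
    omega
  · rw [mul_comm]
    exact Nat.mul_le_mul_right _ (card_voidSlot_le enc S pub)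

end State

/-! ### The protocol for one block: broadcast, flags, claims, outputs. -/

section Protocol

variable {X : Type} [Inhabited X] {M : Fin 4 → Fin 4 → Type} [∀ a b, Inhabited (M a b)]
  {N : ℕ} [NeZero N]

/-- The message on the link from `a` to `b` in a round: code symbols for every unit of a slot,
the payload that `a` broadcasts, and the payloads of the previous round that it relays. -/
abbrev LinkMessage (X : Type) (M : Fin 4 → Fin 4 → Type) (N : ℕ) (a b : Fin 4) : Type :=
  (Fin N → M a b) × Payload X M N a × (∀ s, Payload X M N s)

/-- The messages that a node receives in all rounds. -/
abbrev Inbox (X : Type) (M : Fin 4 → Fin 4 → Type) (N : ℕ) (b : Fin 4) : Type :=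
  ℕ → ∀ a, LinkMessage X M N a b

open scoped Classical in
/-- The value on which at least two of the nodes other than `s` agree. -/
noncomputable def majorityOfReceivers {α : Type} [Inhabited α] (s : Fin 4) (g : Fin 4 → α) : α :=
  if h : ∃ v, ∃ c d, c ≠ d ∧ c ≠ s ∧ d ≠ s ∧ g c = v ∧ g d = v then h.choose else default

/-- Any two different receivers include one other than `f`. -/
theorem majorityOfReceivers_eq {α : Type} [Inhabited α] {s f : Fin 4} {g : Fin 4 → α} {v : α}
    (hg : ∀ c, c ≠ s → c ≠ f → g c = v) : majorityOfReceivers s g = v := by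
  have h4 : ∀ s f : Fin 4, ∃ c d : Fin 4, c ≠ d ∧ c ≠ s ∧ d ≠ s ∧ c ≠ f ∧ d ≠ f := by decide
  obtain ⟨c, d, hcd, hcs, hds, hcf, hdf⟩ := h4 s f
  have h : ∃ v, ∃ c d, c ≠ d ∧ c ≠ s ∧ d ≠ s ∧ g c = v ∧ g d = v :=
    ⟨v, c, d, hcd, hcs, hds, hg c hcs hcf, hg d hds hdf⟩
  rw [majorityOfReceivers, dif_pos h]
  obtain ⟨c, d, hcd, hcs, hds, hc, hd⟩ := h.choose_spec
  by_cases hcf : c = f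
  · rw [← hd]
    exact hg d hds fun h => hcd (hcf.trans h.symm)
  · rw [← hc]
    exact hg c hcs hcf

open scoped Classical in
/-- The value on which all nodes but one agree. -/
noncomputable def majorityOfNodes {α : Type} [Inhabited α] (g : Fin 4 → α) : α :=
  if h : ∃ v, ∃ w, ∀ c, c ≠ w → g c = v then h.choose else default

theorem majorityOfNodes_eq {α : Type} [Inhabited α] {f : Fin 4} {g : Fin 4 → α} {v : α}
    (hg : ∀ c, c ≠ f → g c = v) : majorityOfNodes g = v := by
  have h : ∃ v, ∃ w, ∀ c, c ≠ w → g c = v := ⟨v, f, hg⟩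
  rw [majorityOfNodes, dif_pos h]
  obtain ⟨w, hw⟩ := h.choose_spec
  have h4 : ∀ w f : Fin 4, ∃ c, c ≠ w ∧ c ≠ f := by decide
  obtain ⟨c, hcw, hcf⟩ := h4 w f
  rw [← hw c hcw, hg c hcf]

open scoped Classical in
/-- What node `b` takes to be the payload that `s` broadcast in round `t`. -/
noncomputable def heardPayload (b : Fin 4) (V : Inbox X M N b) (t : ℕ) (s : Fin 4) :
    Payload X M N s :=
  majorityOfReceivers s fun c =>
    -- The vote of `s` is never counted. Node `b` votes with what it got directly, the others with
    -- what they relay one round later; for `b = s` all three votes are relayed.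
    if c = s then default else if c = b then (V t s).2.1 else (V (t + 1) c).2.2 s

variable (enc : ∀ a b, X → M a b) (S : ℕ) (pub : ℕ → ∀ b, Payload X M N b)

open scoped Classical in
/-- The messages received for unit `u` of slot `s`: sources send them in round `s`, and the
other nodes in round `s + 1`. -/
noncomputable def slotMessages (σ : PublicState) {b : Fin 4} (V : Inbox X M N b) (s : ℕ)
    (u : Fin N) (a : Fin 4) : M a b :=
  if σ.IsSource a then (V s a).1 u else (V (s + 1) a).1 u

open scoped Classical in
/-- The word for unit `u` that node `a` encodes in round `t`. -/
noncomputable def sentWord (a : Fin 4) (x : ℕ → Fin N → X) (V : Inbox X M N a) (t : ℕ)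
    (u : Fin N) : X :=
  let σ := publicState enc S pub t
  -- In round 0 there is nothing to decode; what a node that is no source sends then is never read
  -- by `slotMessages`.
  if σ.IsSource a ∨ t = 0 then x t u
  else decodeWord enc σ.sources.1 σ.sources.2 a
    ((V (t - 1) σ.sources.1).1 u) ((V (t - 1) σ.sources.2).1 u)

open scoped Classical in
/-- The mismatch flags that node `b` broadcasts in round `t`. -/
noncomputable def sentFlags (b : Fin 4) (x : ℕ → Fin N → X) (V : Inbox X M N b) (t : ℕ)
    (u : Fin N) : Bool :=
  decide (2 ≤ t ∧ publicState enc S pub (t - 2) = publicState enc S pub (t - 1) ∧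
    Mismatch enc (publicState enc S pub (t - 2)) b (x (t - 2) u)
      (slotMessages (publicState enc S pub (t - 2)) V (t - 2) u))

open scoped Classical in
/-- The word and the received messages that node `b` broadcasts in round `t`: those of the
investigated unit, and after the last slot the words of the void slots. -/
noncomputable def sentClaim (b : Fin 4) (x : ℕ → Fin N → X) (V : Inbox X M N b) (t : ℕ) :
    X × (∀ a, M a b) :=
  if t < 4 then default
  else if t < S + 6 then
    let σ := publicState enc S pub (t - 4)
    let u := flaggedUnit pub σ (t - 4)
    (x (t - 4) u, slotMessages σ V (t - 4) u)
  else
    let z := Nat.nth (VoidPos enc S pub) (t - (S + 6))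
    (x (z / N) (Fin.ofNat N z), default)

/-- The message from `a` to `b` in round `t`. -/
noncomputable def sendWith (a b : Fin 4) (x : ℕ → Fin N → X) (V : Inbox X M N a) (t : ℕ) :
    LinkMessage X M N a b :=
  (fun u => enc a b (sentWord enc S pub a x V t u),
    (sentFlags enc S pub a x V t, sentClaim enc S pub a x V t),
    fun s => if t = 0 then default else (V (t - 1) s).2.1)

open scoped Classical in
/-- The output of node `b` for unit `u` of slot `s`. -/
noncomputable def outputWith (b : Fin 4) (x : ℕ → Fin N → X) (V : Inbox X M N b) (s : ℕ)
    (u : Fin N) : X :=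
  if (publicState enc S pub (S + 5)).1.Nonempty then
    if VoidSlot enc S pub s then
      majorityOfNodes fun c =>
        (pub (S + 6 + Nat.count (VoidPos enc S pub) (s * N + u)) c).2.1
    else nodeWord enc (publicState enc S pub s) b (x s u)
      (slotMessages (publicState enc S pub s) V s u)
  else default

noncomputable def nodeSend (a b : Fin 4) (x : ℕ → Fin N → X) (V : Inbox X M N a) (t : ℕ) :
    LinkMessage X M N a b :=
  sendWith enc S (heardPayload a V) a b x V t

noncomputable def nodeOutput (b : Fin 4) (x : ℕ → Fin N → X) (V : Inbox X M N b) (s : ℕ)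
    (u : Fin N) : X :=
  outputWith enc S (heardPayload b V) b x V s u

/-- The number of rounds of the protocol for one generation. -/
def rounds (S N : ℕ) : ℕ := S + 48 * N + 7

omit [NeZero N] in
theorem heardPayload_congr {b : Fin 4} {V V' : Inbox X M N b} {t : ℕ}
    (h : ∀ l, l < t → V l = V' l) {l : ℕ} (hl : l + 2 ≤ t) :
    heardPayload b V l = heardPayload b V' l := by
  funext s
  rw [heardPayload, heardPayload, h l (by omega), h (l + 1) (by omega)]

omit [∀ a b, Inhabited (M a b)] in
theorem voidPos_congr {pub pub' : ℕ → ∀ b, Payload X M N b}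
    (h : ∀ t, t ≤ S + 5 → publicState enc S pub t = publicState enc S pub' t) :
    VoidPos enc S pub = VoidPos enc S pub' := by
  funext z
  refine propext (and_congr_right fun hz => ?_)
  have : z / N < S := Nat.div_lt_of_lt_mul (by rwa [mul_comm])
  rw [VoidSlot, VoidSlot, h _ (by omega), h _ (by omega)]

theorem sendWith_congr {pub pub' : ℕ → ∀ b, Payload X M N b} {a : Fin 4} (b : Fin 4)
    (x : ℕ → Fin N → X) {V V' : Inbox X M N a} {t : ℕ} (hV : ∀ l, l < t → V l = V' l)
    (hp : ∀ l, l + 2 ≤ t → pub l = pub' l) :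
    sendWith enc S pub a b x V t = sendWith enc S pub' a b x V' t := by
  have hσ : ∀ l, l ≤ t → publicState enc S pub l = publicState enc S pub' l := fun l hl =>
    publicState_congr enc S l fun l' hl' => hp l' (by omega)
  have hw : sentWord enc S pub a x V t = sentWord enc S pub' a x V' t := by
    funext u
    rw [sentWord, sentWord, hσ t le_rfl]
    rcases Nat.eq_zero_or_pos t with rfl | ht
    · simp
    · rw [hV (t - 1) (by omega)]
  have hf : sentFlags enc S pub a x V t = sentFlags enc S pub' a x V' t := by
    funext u
    rw [sentFlags, sentFlags]
    by_cases ht : 2 ≤ t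
    · unfold slotMessages
      rw [hσ (t - 2) (by omega), hσ (t - 1) (by omega), hV (t - 2) (by omega),
        hV (t - 2 + 1) (by omega)]
    · simp [ht]
  have hc : sentClaim enc S pub a x V t = sentClaim enc S pub' a x V' t := by
    rw [sentClaim, sentClaim]
    split_ifs with h4 h6
    · rfl
    · unfold slotMessages
      dsimp only
      rw [hσ (t - 4) (by omega), hV (t - 4) (by omega), hV (t - 4 + 1) (by omega),
        flaggedUnit_congr _ _ (hp (t - 4 + 2) (by omega))]
    · rw [voidPos_congr enc S fun l hl => hσ l (by omega)]
  rw [sendWith, sendWith, hw, hf, hc]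
  congr 2
  funext s
  split_ifs with h
  · rfl
  · rw [hV (t - 1) (by omega)]

theorem nodeSend_congr {a : Fin 4} (b : Fin 4) (x : ℕ → Fin N → X) {V V' : Inbox X M N a} {t : ℕ}
    (h : ∀ l, l < t → V l = V' l) : nodeSend enc S a b x V t = nodeSend enc S a b x V' t :=
  sendWith_congr enc S b x h fun _ hl => heardPayload_congr h hl

omit [∀ a b, Inhabited (M a b)] in
theorem outputWith_congr {pub pub' : ℕ → ∀ b, Payload X M N b} {b : Fin 4} (x : ℕ → Fin N → X)
    {V V' : Inbox X M N b} (hV : ∀ l, l < rounds S N → V l = V' l)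
    (hp : ∀ l, l + 2 ≤ rounds S N → pub l = pub' l) {s : ℕ} (hs : s < S) (u : Fin N) :
    outputWith enc S pub b x V s u = outputWith enc S pub' b x V' s u := by
  have hσ : ∀ l, l ≤ S + 5 → publicState enc S pub l = publicState enc S pub' l := fun l hl =>
    publicState_congr enc S l fun l' hl' => hp l' (by unfold rounds; omega)
  have hpos : s * N + u < S * N := by
    have := u.2
    nlinarith
  have hdiv : (s * N + u) / N = s := by
    rw [mul_comm, Nat.mul_add_div (Nat.pos_of_neZero N), Nat.div_eq_of_lt u.2, add_zero]
  have hvoid := voidPos_congr enc S hσ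
  have hslot : VoidSlot enc S pub s = VoidSlot enc S pub' s := by
    rw [VoidSlot, VoidSlot, hσ s (by omega), hσ (s + 6) (by omega)]
  rw [outputWith, outputWith, hσ (S + 5) le_rfl, hσ s (by omega), hslot, ← hvoid]
  split_ifs with _ hv
  · have hz : VoidPos enc S pub (s * N + u) := ⟨hpos, by rwa [hdiv, hslot]⟩
    -- The last repair broadcast is in round `S + 48 * N + 5` at the latest and is relayed in the
    -- next one, which is why `rounds` ends with 7.
    have := count_voidPos_lt enc S pub hz
    rw [hp _ (by unfold rounds; omega)]
  · unfold slotMessages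
    rw [hV s (by unfold rounds; omega), hV (s + 1) (by unfold rounds; omega)]
  · rfl

theorem nodeOutput_congr {b : Fin 4} (x : ℕ → Fin N → X) {V V' : Inbox X M N b}
    (h : ∀ l, l < rounds S N → V l = V' l) {s : ℕ} (hs : s < S) (u : Fin N) :
    nodeOutput enc S b x V s u = nodeOutput enc S b x V' s u :=
  outputWith_congr enc S x h (fun _ hl => heardPayload_congr h hl) hs u

end Protocol

/-! ### Consistency and validity for one block. -/

section Correctness

variable {X : Type} [Inhabited X] {M : Fin 4 → Fin 4 → Type} [∀ a b, Inhabited (M a b)]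
  {N : ℕ} [NeZero N] {enc : ∀ a b, X → M a b} {S : ℕ} {f : Fin 4} {x : Fin 4 → ℕ → Fin N → X}
  {m : ∀ a b, ℕ → LinkMessage X M N a b}

/-- Node `a` follows the protocol. -/
def Follows (enc : ∀ a b, X → M a b) (S : ℕ) (x : Fin 4 → ℕ → Fin N → X)
    (m : ∀ a b, ℕ → LinkMessage X M N a b) (a : Fin 4) : Prop :=
  ∀ b, b ≠ a → ∀ t, t < rounds S N → m a b t = nodeSend enc S a b (x a) (fun l c => m c a l) t

/-- The messages that `b` receives. -/
abbrev inboxOf (m : ∀ a b, ℕ → LinkMessage X M N a b) (b : Fin 4) : Inbox X M N b :=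
  fun l c => m c b l

theorem heardPayload_of_honest (hm : ∀ a, a ≠ f → Follows enc S x m a) {b s : Fin 4}
    (hs : s ≠ f) {t : ℕ} (ht : t + 1 < rounds S N) :
    heardPayload b (inboxOf m b) t s =
      (sendWith enc S (heardPayload s (inboxOf m s)) s s (x s) (inboxOf m s) t).2.1 := by
  have hsend : ∀ c, c ≠ s → (m s c t).2.1 =
      (sendWith enc S (heardPayload s (inboxOf m s)) s s (x s) (inboxOf m s) t).2.1 := by
    intro c hc
    rw [hm s hs c hc t (by omega)]
    rfl
  refine majorityOfReceivers_eq (f := f) fun c hcs hcf => ?_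
  rw [if_neg hcs]
  split_ifs with hcb
  · subst hcb
    exact hsend c hcs
  · rw [inboxOf, hm c hcf b (Ne.symm hcb) (t + 1) ht]
    simp only [nodeSend, sendWith, Nat.add_one_ne_zero, if_false, Nat.add_sub_cancel]
    exact hsend c hcs

/-- If `f` broadcasts, its three receivers are fault-free and relay truthfully, so all nodes count
the same votes. Otherwise the true payload wins everywhere. -/
theorem heardPayload_eq (hm : ∀ a, a ≠ f → Follows enc S x m a) {b b' : Fin 4} (hb : b ≠ f)
    (hb' : b' ≠ f) {t : ℕ} (ht : t + 1 < rounds S N) :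
    heardPayload b (inboxOf m b) t = heardPayload b' (inboxOf m b') t := by
  funext s
  by_cases hs : s = f
  · subst hs
    have key : ∀ b, b ≠ s → heardPayload b (inboxOf m b) t s =
        majorityOfReceivers s fun c => if c = s then default else (m s c t).2.1 := by
      intro b hb
      rw [heardPayload]
      congr 1
      funext c
      split_ifs with hcs hcb
      · rfl
      · rw [hcb]
      · rw [inboxOf, hm c hcs b (Ne.symm hcb) (t + 1) ht]
        simp [nodeSend, sendWith]
    rw [key b hb, key b' hb']
  · rw [heardPayload_of_honest hm hs ht, heardPayload_of_honest hm hs ht]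

/-- `P` are the payloads that all fault-free nodes hear, and they follow the protocol with
respect to `P`. -/
structure CommonPayloads (enc : ∀ a b, X → M a b) (S : ℕ) (f : Fin 4) (x : Fin 4 → ℕ → Fin N → X)
    (m : ∀ a b, ℕ → LinkMessage X M N a b) (P : ℕ → ∀ b, Payload X M N b) : Prop where
  message : ∀ a, a ≠ f → ∀ b, b ≠ a → ∀ t, t < rounds S N →
    m a b t = sendWith enc S P a b (x a) (inboxOf m a) t
  payload : ∀ a, a ≠ f → ∀ t, t + 1 < rounds S N →
    P t a = (sendWith enc S P a a (x a) (inboxOf m a) t).2.1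
  output : ∀ b, b ≠ f → ∀ s, s < S → ∀ u,
    nodeOutput enc S b (x b) (inboxOf m b) s u = outputWith enc S P b (x b) (inboxOf m b) s u

theorem exists_commonPayloads (hm : ∀ a, a ≠ f → Follows enc S x m a) :
    ∃ P, CommonPayloads enc S f x m P := by
  obtain ⟨b₀, hb₀⟩ := exists_ne f
  refine ⟨heardPayload b₀ (inboxOf m b₀), fun a ha b hb t ht => ?_, fun a ha t ht => ?_,
    fun b hb s hs u => ?_⟩
  · rw [hm a ha b hb t ht]
    exact sendWith_congr enc S b _ (fun _ _ => rfl) fun l hl => heardPayload_eq hm ha hb₀ (by omega)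
  · rw [heardPayload_of_honest hm ha ht]
    rw [sendWith_congr enc S a (x a) (fun _ _ => rfl)
      fun l hl => heardPayload_eq hm ha hb₀ (by omega)]
  · exact outputWith_congr enc S _ (fun _ _ => rfl)
      (fun l hl => heardPayload_eq hm hb hb₀ (by omega)) hs u

namespace CommonPayloads

variable {P : ℕ → ∀ b, Payload X M N b} (h : CommonPayloads enc S f x m P)

include h

/-- Fault-free nodes receive the encoded word of every other fault-free node. -/
theorem slotMessages_eq {s : ℕ} (hs : s < S)
    (hσ : publicState enc S P s = publicState enc S P (s + 1)) (u : Fin N) {a b : Fin 4}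
    (ha : a ≠ f) (hab : a ≠ b) :
    slotMessages (publicState enc S P s) (inboxOf m b) s u a =
      enc a b (nodeWord enc (publicState enc S P s) a (x a s u)
        (slotMessages (publicState enc S P s) (inboxOf m a) s u)) := by
  rw [slotMessages, nodeWord]
  split_ifs with hsrc
  · rw [inboxOf, h.message a ha b hab.symm s (by unfold rounds; omega)]
    simp [sendWith, sentWord, hsrc]
  · rw [inboxOf, h.message a ha b hab.symm (s + 1) (by unfold rounds; omega)]
    simp only [sendWith, sentWord]
    rw [← hσ, if_neg (by simp [hsrc]), slotMessages, slotMessages,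
      if_pos (PublicState.isSource_fst _), if_pos (PublicState.isSource_snd _), Nat.add_sub_cancel]

theorem flags_iff {s : ℕ} (hs : s < S)
    (hσ : publicState enc S P s = publicState enc S P (s + 1)) {b : Fin 4} (hb : b ≠ f)
    (u : Fin N) : (P (s + 2) b).1 u = true ↔ Mismatch enc (publicState enc S P s) b (x b s u)
      (slotMessages (publicState enc S P s) (inboxOf m b) s u) := by
  rw [h.payload b hb (s + 2) (by unfold rounds; omega)]
  have : s + 2 - 1 = s + 1 := rfl
  simp [sendWith, sentFlags, this, hσ]

theorem claim_eq {s : ℕ} (hs : s < S) {b : Fin 4} (hb : b ≠ f) :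
    (P (s + 4) b).2 = (x b s (flaggedUnit P (publicState enc S P s) s),
      slotMessages (publicState enc S P s) (inboxOf m b) s
        (flaggedUnit P (publicState enc S P s) s)) := by
  rw [h.payload b hb (s + 4) (by unfold rounds; omega)]
  simp only [sendWith, sentClaim, if_neg (by omega : ¬ s + 4 < 4),
    if_pos (by omega : s + 4 < S + 6), Nat.add_sub_cancel]

/-- Fault-free nodes claim what really happened, so the faulty node is never cleared of suspicion.
-/
theorem consistentWith {s : ℕ} (hs : s < S)
    (hσ : publicState enc S P s = publicState enc S P (s + 1)) :
    ConsistentWith enc (publicState enc S P s) (fun b => (P (s + 4) b).2.1)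
      (fun b => (P (s + 4) b).2.2)
      (fun b => (P (s + 2) b).1 (flaggedUnit P (publicState enc S P s) s)) f := by
  intro b hb
  refine ⟨fun a ha hab => ?_, ?_⟩
  · simp only [h.claim_eq hs hb, h.claim_eq hs ha]
    exact h.slotMessages_eq hs hσ _ ha hab
  · simp only [h.claim_eq hs hb]
    exact h.flags_iff hs hσ hb _

theorem mem_snd (t : ℕ) : f ∈ (publicState enc S P t).2 := by
  refine publicState_induction enc S P (motive := fun σ => f ∈ σ.2) (by simp) ?_ t
  intro s hs hσ _ ih
  exact PublicState.mem_update_snd.2 ⟨ih, h.consistentWith hs hσ⟩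

theorem mem_fst (hx : ∀ a b, a ≠ f → b ≠ f → ∀ s, s < S → x a s = x b s) (t : ℕ) :
    f ∈ (publicState enc S P t).1 := by
  refine publicState_induction enc S P (motive := fun σ => f ∈ σ.1) (by simp) ?_ t
  intro s hs hσ _ ih
  refine PublicState.mem_update_fst.2 ⟨ih, h.consistentWith hs hσ, fun a b ha hb => ?_⟩
  simp only [h.claim_eq hs ha, h.claim_eq hs hb, hx a b ha hb s hs]

/-- As `f` stays in `C`, links between fault-free nodes are checked and flags of fault-free nodes
are credible. A slot that is not void has no such flag, so `IsLinkCode.eq_of_enc_eq` applies. -/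
theorem nodeWord_eq (henc : IsLinkCode enc) {s : ℕ} (hs : s < S)
    (hv : ¬ VoidSlot enc S P s) (hH : (publicState enc S P s).1.Nonempty) (u : Fin N) {a b : Fin 4}
    (ha : a ≠ f) (hb : b ≠ f) :
    nodeWord enc (publicState enc S P s) a (x a s u)
      (slotMessages (publicState enc S P s) (inboxOf m a) s u) =
    nodeWord enc (publicState enc S P s) b (x b s u)
      (slotMessages (publicState enc S P s) (inboxOf m b) s u) := by
  have hσ6 := not_not.1 hv
  have hσ := (publicState_eq_of_le enc S P (by norm_num : 1 ≤ 6) hσ6).symm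
  refine henc.eq_of_enc_eq (f := f) (v := fun a => nodeWord enc (publicState enc S P s) a (x a s u)
    (slotMessages (publicState enc S P s) (inboxOf m a) s u)) (fun a b ha hb hab => ?_) ha hb
  rw [← h.slotMessages_eq hs hσ u ha hab]
  by_contra hne
  have hmis : Mismatch enc (publicState enc S P s) b (x b s u)
      (slotMessages (publicState enc S P s) (inboxOf m b) s u) :=
    ⟨a, hab, ⟨f, h.mem_snd s, ha.symm, hb.symm⟩, hne⟩
  exact not_flagged_of_publicState_eq S P henc hs hσ6 hH u
    ⟨b, ⟨f, h.mem_snd s, hb.symm⟩, (h.flags_iff hs hσ hb u).2 hmis⟩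

open scoped Classical in
theorem finalClaim_eq {s : ℕ} (hs : s < S) (hv : VoidSlot enc S P s) (u : Fin N) {b : Fin 4}
    (hb : b ≠ f) :
    (P (S + 6 + Nat.count (VoidPos enc S P) (s * N + u)) b).2.1 = x b s u := by
  have hpos : s * N + u < S * N := by
    have := u.2
    nlinarith
  have hdiv : (s * N + u) / N = s := by
    rw [mul_comm, Nat.mul_add_div (Nat.pos_of_neZero N), Nat.div_eq_of_lt u.2, add_zero]
  have hz : VoidPos enc S P (s * N + u) := ⟨hpos, by rwa [hdiv]⟩
  have hlt : Nat.count (VoidPos enc S P) (s * N + u) < 48 * N := 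
    count_voidPos_lt enc S P hz
  rw [h.payload b hb _ (by unfold rounds; omega)]
  have hofNat : Fin.ofNat N (s * N + u) = u := by
    ext
    simp [Fin.ofNat, Nat.mod_eq_of_lt u.2]
  have h4 : ¬ S + 6 + Nat.count (VoidPos enc S P) (s * N + u) < 4 := by omega
  have h6 : ¬ S + 6 + Nat.count (VoidPos enc S P) (s * N + u) < S + 6 := by omega
  simp only [sendWith, sentClaim, if_neg h4, if_neg h6, Nat.add_sub_cancel_left,
    Nat.nth_count hz, hdiv, hofNat]

end CommonPayloads

/-- The outputs of all fault-free nodes are equal. -/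
theorem nodeOutput_eq (henc : IsLinkCode enc) (hm : ∀ a, a ≠ f → Follows enc S x m a)
    {a b : Fin 4} (ha : a ≠ f) (hb : b ≠ f) {s : ℕ} (hs : s < S) (u : Fin N) :
    nodeOutput enc S a (x a) (inboxOf m a) s u = nodeOutput enc S b (x b) (inboxOf m b) s u := by
  obtain ⟨P, h⟩ := exists_commonPayloads hm
  rw [h.output a ha s hs, h.output b hb s hs, outputWith, outputWith]
  split_ifs with hH hv
  · rfl
  · exact h.nodeWord_eq henc hs hv
      (hH.mono (publicState_antitone enc S P (by omega : s ≤ S + 5)).1) u ha hb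
  · rfl

/-- If all fault-free nodes hold the same input, then it is their output. -/
theorem nodeOutput_eq_input (henc : IsLinkCode enc) (hm : ∀ a, a ≠ f → Follows enc S x m a)
    (hx : ∀ a b, a ≠ f → b ≠ f → ∀ s, s < S → x a s = x b s) {a : Fin 4} (ha : a ≠ f) {s : ℕ}
    (hs : s < S) (u : Fin N) :
    nodeOutput enc S a (x a) (inboxOf m a) s u = x a s u := by
  obtain ⟨P, h⟩ := exists_commonPayloads hm
  rw [h.output a ha s hs, outputWith, if_pos ⟨f, h.mem_fst hx _⟩]
  split_ifs with hv
  · refine majorityOfNodes_eq (f := f) fun c hc => ?_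
    rw [h.finalClaim_eq hs hv u hc, hx c a hc ha s hs]
  -- One of the two sources is fault-free and keeps its own input, which is then the common word.
  · have hsrc : ∃ b, b ≠ f ∧ (publicState enc S P s).IsSource b := by
      have := (publicState enc S P s).sources_ne
      by_cases h1 : (publicState enc S P s).sources.1 = f
      · exact ⟨_, fun h2 => this (h1.trans h2.symm), .inr rfl⟩
      · exact ⟨_, h1, .inl rfl⟩
    obtain ⟨b, hb, hsb⟩ := hsrc
    rw [h.nodeWord_eq henc hs hv ⟨f, h.mem_fst hx _⟩ u ha hb, nodeWord, if_pos hsb,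
      hx b a hb ha s hs]

end Correctness

/-! ### From a block protocol to an algorithm on infinite inputs. -/

/-- A protocol by which the four nodes agree on one block of `D` bits in `K` rounds, where in each
round the link from `a` to `b` carries `bits a b` bits. -/
structure BlockProtocol where
  Msg : Fin 4 → Fin 4 → Type
  [inhabitedMsg : ∀ a b, Inhabited (Msg a b)]
  bits : Fin 4 → Fin 4 → ℕ
  encodeMsg : ∀ a b, Msg a b ≃ (Fin (bits a b) → Bool)
  Block : Type
  D : ℕ
  encodeBlock : Block ≃ (Fin D → Bool)
  K : ℕ
  send : (a b : Fin 4) → ℕ → Block → (ℕ → ∀ c, Msg c a) → Msg a b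
  out : (a : Fin 4) → Block → (ℕ → ∀ c, Msg c a) → Block
  send_congr : ∀ a b t x V V', (∀ l, l < t → V l = V' l) → send a b t x V = send a b t x V'
  out_congr : ∀ a x V V', (∀ l, l < K → V l = V' l) → out a x V = out a x V'

attribute [instance] BlockProtocol.inhabitedMsg

namespace BlockProtocol

variable (B : BlockProtocol)

/-- In the execution with inputs `x` and messages `m` all nodes but `f` follow the protocol. -/
def FollowedExcept (x : Fin 4 → B.Block) (m : ∀ a b, ℕ → B.Msg a b) (f : Fin 4) : Prop :=
  ∀ a, a ≠ f → ∀ b, b ≠ a → ∀ t, t < B.K → m a b t = B.send a b t (x a) fun l c => m c a l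

/-- The protocol is consistent and valid in the presence of at most one faulty node. -/
structure Correct : Prop where
  consistent : ∀ x m f, B.FollowedExcept x m f → ∀ a b, a ≠ f → b ≠ f →
    B.out a (x a) (fun l c => m c a l) = B.out b (x b) (fun l c => m c b l)
  valid : ∀ x m f, B.FollowedExcept x m f → ∀ y, (∀ a, a ≠ f → x a = y) → ∀ a, a ≠ f →
    B.out a (x a) (fun l c => m c a l) = y

/-- The number of bits on a link; there are no links from a node to itself. -/
def len (a b : Fin 4) : ℕ := if a = b then 0 else B.bits a b

def toBits (a b : Fin 4) (μ : B.Msg a b) (y : Fin (B.len a b)) : Bool :=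
  B.encodeMsg a b μ ⟨y, y.2.trans_le (by unfold len; split_ifs <;> simp)⟩

def ofBits (a b : Fin 4) (μ : Fin (B.len a b) → Bool) : B.Msg a b :=
  if h : a = b then default
  else (B.encodeMsg a b).symm fun y => μ ⟨y, by simp [len, h]⟩

theorem ofBits_toBits {a b : Fin 4} (h : a ≠ b) (μ : B.Msg a b) :
    B.ofBits a b (B.toBits a b μ) = μ := by
  simp [ofBits, toBits, h]

/-- Block number `g` of an infinite sequence of bits. -/
def block (v : ℕ → Bool) (g : ℕ) : B.Block := B.encodeBlock.symm fun y => v (g * B.D + y)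

theorem encodeBlock_block (v : ℕ → Bool) (g : ℕ) (y : Fin B.D) :
    B.encodeBlock (B.block v g) y = v (g * B.D + y) := by
  simp [block]

/-- What a node with the given view has received in the rounds for block `g`. -/
def inbox {i : Fin 4} {k : ℕ} (view : View (fun a b _ => B.len a b) i k) (g l : ℕ) (c : Fin 4) :
    B.Msg c i :=
  if h : g * B.K + l < k then B.ofBits c i (view ⟨g * B.K + l, h⟩ c) else default

variable {G : Network 4} {δ : ℝ} (hδ : 0 < δ)
  (hlen : ∀ a b, a ≠ b → (B.bits a b : ℝ) ≤ δ * G.cap a b) (hD : 0 < B.D) (hK : 0 < B.K)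

/-- The algorithm that processes the blocks of the input one after the other. -/
noncomputable def algorithm : Algorithm G where
  time k := k * δ
  time_zero := by simp
  time_strictMono := fun a b hab => by
    have : (a : ℝ) < b := by exact_mod_cast hab
    exact mul_lt_mul_of_pos_right this hδ
  time_tendsto := tendsto_natCast_atTop_atTop.atTop_mul_const hδ
  len a b _ := B.len a b
  len_le a b k := by
    have : ((k + 1 : ℕ) : ℝ) * δ - k * δ = δ := by push_cast; ring
    rw [this, len]
    split_ifs with h
    · simp only [Nat.cast_zero]
      positivity
    · exact hlen a b h
  send i j k v view :=
    B.toBits i j (B.send i j (k % B.K) (B.block v (k / B.K)) (B.inbox view (k / B.K)))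
  output i k v view m :=
    if (m / B.D + 1) * B.K ≤ k then
      some (B.encodeBlock (B.out i (B.block v (m / B.D)) (B.inbox view (m / B.D)))
        ⟨m % B.D, Nat.mod_lt m hD⟩)
    else none

variable (E : Execution (B.algorithm hδ hlen hD))

/-- The messages in the rounds for block `g`. -/
def blockMsg (g : ℕ) (a b : Fin 4) (l : ℕ) : B.Msg a b := B.ofBits a b (E.msg a b (g * B.K + l))

theorem followedExcept {f : Fin 4} (hf : E.faulty ⊆ {f}) (g : ℕ) :
    B.FollowedExcept (fun a => B.block (E.input a) g) (B.blockMsg hδ hlen hD E g) f := by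
  intro a ha b hb t ht
  have hfol := E.follows a (fun h => ha (by simpa using hf h)) b (g * B.K + t)
  rw [blockMsg, hfol]
  simp only [algorithm]
  have hdiv : (g * B.K + t) / B.K = g := by
    rw [mul_comm, Nat.mul_add_div (by omega), Nat.div_eq_of_lt ht, add_zero]
  rw [B.ofBits_toBits hb.symm, Nat.mul_add_mod_of_lt ht, hdiv]
  refine B.send_congr _ _ _ _ _ _ fun l hl => ?_
  funext c
  simp only [inbox, dif_pos (Nat.add_lt_add_left hl _)]
  rfl

/-- The output of node `a` for block `g`. -/
def blockOut (g : ℕ) (a : Fin 4) : B.Block :=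
  B.out a (B.block (E.input a) g) fun l c => B.blockMsg hδ hlen hD E g c a l

theorem out_eq (i : Fin 4) (k m : ℕ) : E.out i k m =
    if (m / B.D + 1) * B.K ≤ k then
      some (B.encodeBlock (B.blockOut hδ hlen hD E (m / B.D) i) ⟨m % B.D, Nat.mod_lt m hD⟩)
    else none := by
  simp only [Execution.out, algorithm]
  split_ifs with h
  · have : B.out i (B.block (E.input i) (m / B.D))
        (B.inbox (i := i) (k := k) (fun l j => E.msg j i l) (m / B.D)) =
        B.blockOut hδ hlen hD E (m / B.D) i := by
      refine B.out_congr _ _ _ _ fun l hl => ?_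
      funext c
      have : m / B.D * B.K + l < k := by
        rw [add_mul, one_mul] at h
        omega
      simp only [inbox, dif_pos this]
      rfl
    rw [← this]
  · rfl

/-- The sequence that node `i` outputs. -/
def outputSeq (i : Fin 4) (m : ℕ) : Bool :=
  B.encodeBlock (B.blockOut hδ hlen hD E (m / B.D) i) ⟨m % B.D, Nat.mod_lt m hD⟩

theorem decides_iff (i : Fin 4) (v : ℕ → Bool) :
    E.Decides i v ↔ v = B.outputSeq hδ hlen hD E i := by
  constructor
  · intro h
    funext m
    obtain ⟨k, hk⟩ := h m
    rw [out_eq] at hk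
    split_ifs at hk
    exact (Option.some_inj.1 hk).symm
  · rintro rfl m
    exact ⟨(m / B.D + 1) * B.K, by rw [out_eq, if_pos le_rfl]; rfl⟩

theorem agreedBy_iff (hK : 0 < B.K) (t : ℝ) (i : Fin 4) (m : ℕ) :
    E.AgreedBy t i m ↔ m < B.D * ⌊(B.K * δ)⁻¹ * t⌋₊ := by
  have hP : 0 < (B.K : ℝ) * δ := by positivity
  have h1 : E.AgreedBy t i m ↔ (((m / B.D + 1 : ℕ) : ℝ) * (B.K * δ)) ≤ t := by
    constructor
    · rintro ⟨k, hk, hs⟩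
      rw [out_eq] at hs
      split_ifs at hs with h
      · refine le_trans ?_ hk
        rw [← mul_assoc]
        exact mul_le_mul_of_nonneg_right (by exact_mod_cast h) hδ.le
      · simp at hs
    · intro h
      refine ⟨(m / B.D + 1) * B.K, ?_, ?_⟩
      · simp only [algorithm]
        push_cast at h ⊢
        linarith
      · rw [out_eq, if_pos le_rfl]
        rfl
  rw [h1, ← le_div_iff₀ hP, ← Nat.le_floor_iff' (Nat.succ_ne_zero _), div_eq_inv_mul, Nat.add_one_le_iff,
    Nat.div_lt_iff_lt_mul hD, mul_comm]

theorem agreedBits_eq (hK : 0 < B.K) {i : Fin 4} (hi : i ∉ E.faulty) (t : ℝ) :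
    E.agreedBits t = ((B.D * ⌊(B.K * δ)⁻¹ * t⌋₊ : ℕ) : ℕ∞) := by
  refine le_antisymm (iSup₂_le fun b hb => ?_) (le_iSup₂_of_le _ (fun i _ m hm => ?_) le_rfl)
  · rw [Nat.cast_le]
    by_contra! hlt
    exact lt_irrefl _ ((B.agreedBy_iff hδ hlen hD E hK t i _).1 (hb i hi _ hlt))
  · exact (B.agreedBy_iff hδ hlen hD E hK t i m).2 hm

theorem hasThroughput (hK : 0 < B.K) {i : Fin 4} (hi : i ∉ E.faulty) :
    E.HasThroughput (ENNReal.ofReal (B.D / (B.K * δ))) := by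
  have hP : 0 < (B.K : ℝ) * δ := by positivity
  have h := (tendsto_nat_floor_mul_div_atTop (R := ℝ) (inv_pos.2 hP).le).const_mul (B.D : ℝ)
  rw [← div_eq_mul_inv] at h
  refine ((ENNReal.continuous_ofReal.tendsto _).comp h).congr' ?_
  filter_upwards [eventually_gt_atTop 0] with t ht
  rw [B.agreedBits_eq hδ hlen hD E hK hi, ENat.toENNReal_coe, Function.comp_apply, ← mul_div_assoc,
    ENNReal.ofReal_div_of_pos ht, ← ENNReal.ofReal_natCast]
  push_cast
  rfl

include hK in
/-- Repeating a correct block protocol achieves its rate. -/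
theorem achieves (hB : B.Correct) :
    (B.algorithm hδ hlen hD).Achieves 1 (ENNReal.ofReal (B.D / (B.K * δ))) := by
  intro E hE
  have hne : ∀ f : Fin 4, ∃ a, a ≠ f := exists_ne
  have hsub : ∃ f, E.faulty ⊆ {f} := Finset.card_le_one_iff_subset_singleton.1 hE
  -- `BlockProtocol.Correct` always names an exceptional node; if none is faulty, any node other
  -- than `a` and `b` will do.
  have hpair : ∀ a b, a ∉ E.faulty → b ∉ E.faulty → ∃ f, E.faulty ⊆ {f} ∧ a ≠ f ∧ b ≠ f := by
    intro a b ha hb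
    obtain ⟨f, hf⟩ := hsub
    rcases Finset.subset_singleton_iff.1 hf with h | h
    · obtain ⟨f', h1, h2⟩ : ∃ f', a ≠ f' ∧ b ≠ f' := by
        have : ∀ a b : Fin 4, ∃ f', a ≠ f' ∧ b ≠ f' := by decide
        exact this a b
      exact ⟨f', by simp [h], h1, h2⟩
    · rw [h] at ha hb
      exact ⟨f, hf, by simpa using ha, by simpa using hb⟩
  refine ⟨?_, fun i _ => ⟨_, (B.decides_iff hδ hlen hD E i _).2 rfl⟩, ?_, ?_, ?_⟩
  · intro i _ m b k l hkl h
    rw [out_eq] at h ⊢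
    split_ifs at h with hk
    rw [if_pos (hk.trans hkl), h]
  · intro i hi j hj v w hv hw
    rw [decides_iff] at hv hw
    obtain ⟨f, hf, hif, hjf⟩ := hpair i j hi hj
    rw [hv, hw]
    funext m
    unfold outputSeq blockOut
    rw [hB.consistent _ _ f (B.followedExcept hδ hlen hD E hf (m / B.D)) i j hif hjf]
  · intro v hv i hi w hw
    rw [decides_iff] at hw
    obtain ⟨f, hf, hif, -⟩ := hpair i i hi hi
    rw [hw]
    funext m
    unfold outputSeq blockOut
    rw [hB.valid _ _ f (B.followedExcept hδ hlen hD E hf (m / B.D)) (B.block v (m / B.D))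
      (fun a ha => by rw [hv a fun h => ha (by simpa using hf h)]) i hif, encodeBlock_block,
      mul_comm, Nat.div_add_mod]
  · obtain ⟨f, hf⟩ := hsub
    obtain ⟨a, ha⟩ := exists_ne f
    exact ⟨_, le_rfl, B.hasThroughput hδ hlen hD E hK fun h => ha (by simpa using hf h)⟩

end BlockProtocol

/-! ### Choice of parameters and the limiting rate. -/

section Parameters

/-- Words of `r` symbols of `w` bits each. -/
abbrev Word (r w : ℕ) : Type := Fin r → Fin w → Bool

/-- The code symbols on the links, where the link from `a` to `b` carries `n a b` symbols. -/
abbrev LinkSymbols (n : Fin 4 → Fin 4 → ℕ) (w : ℕ) (a b : Fin 4) : Type := Fin (n a b) → Fin w → Bool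

variable (n : Fin 4 → Fin 4 → ℕ) (r w N S : ℕ)

def payloadBits (s : Fin 4) : ℕ := N + (r * w + ∑ c, n c s * w)

def messageBits (a b : Fin 4) : ℕ :=
  N * (n a b * w) + (payloadBits n r w N a + ∑ s, payloadBits n r w N s)

theorem card_payload (s : Fin 4) :
    Fintype.card (Payload (Word r w) (LinkSymbols n w) N s) = 2 ^ payloadBits n r w N s := by
  simp only [Payload, Fintype.card_prod, Fintype.card_pi, Fintype.card_bool, Finset.prod_const,
    Finset.card_univ, Fintype.card_fin, payloadBits, pow_add, ← pow_mul, Finset.prod_pow_eq_pow_sum,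
    mul_comm w]

theorem card_linkMessage (a b : Fin 4) :
    Fintype.card (LinkMessage (Word r w) (LinkSymbols n w) N a b) = 2 ^ messageBits n r w N a b := by
  have h : Fintype.card (LinkMessage (Word r w) (LinkSymbols n w) N a b) =
      Fintype.card (Fin N → LinkSymbols n w a b) *
        (Fintype.card (Payload (Word r w) (LinkSymbols n w) N a) *
          ∏ s, Fintype.card (Payload (Word r w) (LinkSymbols n w) N s)) := by
    rw [← Fintype.card_pi, ← Fintype.card_prod, ← Fintype.card_prod]
  rw [h]
  simp only [card_payload]
  simp only [Fintype.card_pi, Fintype.card_bool, Finset.prod_const,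
    Finset.card_univ, Fintype.card_fin, messageBits, pow_add, ← pow_mul, Finset.prod_pow_eq_pow_sum,
    mul_comm w, mul_comm N]

theorem card_block : Fintype.card (Fin S → Fin N → Word r w) = 2 ^ (w * r * N * S) := by
  simp only [Fintype.card_pi, Fintype.card_bool, Finset.prod_const,
    Finset.card_univ, Fintype.card_fin, ← pow_mul]

variable {n r w N S}

/-- The input of a node for a block, with default words after the last slot. -/
def extendSlots (x : Fin S → Fin N → Word r w) (s : ℕ) (u : Fin N) : Word r w :=
  if h : s < S then x ⟨s, h⟩ u else default

/-- The block protocol with `S` slots of `N` units. -/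
noncomputable def blockProtocol [NeZero N] (S : ℕ) (enc : ∀ a b, Word r w → LinkSymbols n w a b) :
    BlockProtocol where
  Msg := LinkMessage (Word r w) (LinkSymbols n w) N
  inhabitedMsg _ _ := ⟨default, default, default⟩
  bits := messageBits n r w N
  encodeMsg a b := Fintype.equivOfCardEq (by rw [card_linkMessage]; simp)
  Block := Fin S → Fin N → Word r w
  D := w * r * N * S
  encodeBlock := Fintype.equivOfCardEq (by rw [card_block]; simp)
  K := rounds S N
  send a b t x V := nodeSend enc S a b (extendSlots x) V t
  out a x V := fun s u => nodeOutput enc S a (extendSlots x) V s u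
  send_congr a b _ x _ _ h := nodeSend_congr enc S b _ h
  out_congr a x V V' h := by
    funext s u
    exact nodeOutput_congr enc S _ h s.2 u

theorem blockProtocol_correct [NeZero N] {enc : ∀ a b, Word r w → LinkSymbols n w a b}
    (henc : IsLinkCode enc) : (blockProtocol (N := N) S enc).Correct where
  consistent x m f hm a b ha hb := by
    refine funext fun s : Fin S => funext fun u => ?_
    exact nodeOutput_eq (x := fun a => extendSlots (x a)) henc hm ha hb s.2 u
  valid x m f hm y hy a ha := by
    refine funext fun s : Fin S => funext fun u => ?_
    have hx : ∀ a b, a ≠ f → b ≠ f → ∀ s, s < S →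
        extendSlots (x a) s = extendSlots (x b) s := fun a b ha hb s _ => by rw [hy a ha, hy b hb]
    refine (nodeOutput_eq_input (x := fun a => extendSlots (x a)) henc hm hx ha s.2 u).trans ?_
    simp [extendSlots, hy a ha]

theorem exists_blockProtocol (hN : N ≠ 0) {enc : ∀ a b, Word r w → LinkSymbols n w a b}
    (henc : IsLinkCode enc) (S : ℕ) : ∃ B : BlockProtocol, B.Correct ∧
      B.bits = messageBits n r w N ∧ B.D = w * r * N * S ∧ B.K = rounds S N :=
  have : NeZero N := ⟨hN⟩
  ⟨blockProtocol S enc, blockProtocol_correct henc, rfl, rfl, rfl⟩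

/-- With symbols of `N` bits, the code symbols of `N` units are quadratic in `N`, while the five
payloads, one own and four relayed, are only linear. -/
theorem messageBits_le (n : Fin 4 → Fin 4 → ℕ) (r N : ℕ) (a b : Fin 4) :
    messageBits n r N N a b ≤ N * N * n a b + N * (5 * (1 + (r + ∑ a, ∑ b, n a b))) := by
  have hp : ∀ s, payloadBits n r N N s ≤ N * (1 + (r + ∑ a, ∑ b, n a b)) := by
    intro s
    have : ∑ c, n c s ≤ ∑ a, ∑ b, n a b :=
      Finset.sum_le_sum fun c _ => Finset.single_le_sum (f := n c) (fun _ _ => Nat.zero_le _)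
        (Finset.mem_univ s)
    rw [payloadBits, ← Finset.sum_mul]
    nlinarith
  have hs := Finset.sum_le_sum fun s (_ : s ∈ Finset.univ) => hp s
  rw [Finset.sum_const, Finset.card_univ, Fintype.card_fin, smul_eq_mul] at hs
  have := hp a
  rw [messageBits]
  nlinarith

/-- The rate for `w = N = m` and `S = m * m`: bits per block over the number of rounds times their
duration. Repair rounds and payload time are both smaller than the main terms by a factor of order
`m`. -/
theorem tendsto_rate {r τ κ : ℝ} (hτ : 0 < τ) :
    Tendsto (fun m : ℕ => ((m * r * m * (m * m) : ℝ)) /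
      ((m * m + 48 * m + 7) * (m * m * τ + m * κ))) atTop (𝓝 (r / τ)) := by
  have h0 : ∀ C : ℝ, Tendsto (fun m : ℕ => C / (m : ℝ)) atTop (𝓝 0) :=
    tendsto_const_div_atTop_nhds_zero_nat
  have h : Tendsto (fun m : ℕ => r / ((1 + 48 / (m : ℝ) + 7 / m * (1 / m)) * (τ + κ / m))) atTop
      (𝓝 (r / ((1 + 0 + 0 * 0) * (τ + 0)))) := by
    refine tendsto_const_nhds.div (((tendsto_const_nhds.add (h0 _)).add ((h0 _).mul (h0 _))).mul
      (tendsto_const_nhds.add (h0 _))) ?_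
    simpa using hτ.ne'
  have heq : r / ((1 + 0 + 0 * 0) * (τ + 0)) = r / τ := by ring
  rw [heq] at h
  refine h.congr' ?_
  filter_upwards [eventually_gt_atTop 0] with m hm
  have hm' : (m : ℝ) ≠ 0 := by positivity
  have e : ((m * m + 48 * m + 7) * (m * m * τ + m * κ) : ℝ) =
      ((1 + 48 / (m : ℝ) + 7 / m * (1 / m)) * (τ + κ / m)) * (m * m * (m * m)) := by
    field_simp
  have e' : (m * r * m * (m * m) : ℝ) = r * (m * m * (m * m)) := by ring
  rw [e, e', mul_div_mul_right _ _ (by positivity)]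

theorem Algorithm.Achieves.mono {G : Network 4} {A : Algorithm G} {f : ℕ} {R R' : ℝ≥0∞}
    (h : A.Achieves f R') (hR : R ≤ R') : A.Achieves f R := by
  intro E hE
  obtain ⟨h1, h2, h3, h4, r, hr, h5⟩ := h E hE
  exact ⟨h1, h2, h3, h4, r, hR.trans hr, h5⟩

theorem minTwoIncoming_le (G : Network 4) {p q a : Fin 4} (hpq : p ≠ q) (hpa : p ≠ a)
    (hqa : q ≠ a) : G.minTwoIncoming ≤ G.cap p a + G.cap q a :=
  Finset.inf'_le (fun p : Fin 4 × Fin 4 × Fin 4 => G.cap p.2.1 p.1 + G.cap p.2.2 p.1)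
    (b := (a, p, q)) (by simp [triples, hpq, hpa, hqa])

theorem achievable_of_linkSymbols {G : Network 4} (hG : G.IsComplete) {R : ℝ≥0} {T : ℝ}
    (hT0 : 0 < T) {n : Fin 4 → Fin 4 → ℕ} {r : ℕ} (hr0 : 0 < r) (hn : ∀ a b, n a b ≤ T * G.cap a b)
    (hr : ∀ p q a, p ≠ q → p ≠ a → q ≠ a → r ≤ n p a + n q a) (hrT : (R : ℝ) < r / T) :
    G.Achievable 1 R := by
  set Q : ℕ := 5 * (1 + (r + ∑ a, ∑ b, n a b)) with hQ
  -- Time in which every link can carry `Q` bits; the diagonal terms vanish, being divisions by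
  -- zero.
  set κ : ℝ := ∑ a, ∑ b, Q / (G.cap a b : ℝ) with hκ
  have hκ0 : 0 ≤ κ := Finset.sum_nonneg fun a _ => Finset.sum_nonneg fun b _ => by positivity
  have hκc : ∀ a b, a ≠ b → (Q : ℝ) ≤ κ * G.cap a b := by
    intro a b hab
    have hc : 0 < (G.cap a b : ℝ) := by exact_mod_cast hG a b hab
    rw [← div_le_iff₀ hc]
    refine (Finset.single_le_sum (f := fun b => Q / (G.cap a b : ℝ)) (fun _ _ => by positivity)
      (Finset.mem_univ b)).trans ?_
    exact Finset.single_le_sum (f := fun a => ∑ b, Q / (G.cap a b : ℝ))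
      (fun _ _ => Finset.sum_nonneg fun _ _ => by positivity) (Finset.mem_univ a)
  obtain ⟨m, hm, hm0, hmQ⟩ := (((tendsto_rate (κ := κ) hT0).eventually (lt_mem_nhds hrT)).and
    ((eventually_gt_atTop 0).and (eventually_ge_atTop Q))).exists
  have hm0' : (0 : ℝ) < m := by exact_mod_cast hm0
  have hcard : ∑ a, ∑ b, n a b ≤ 2 ^ m := by
    have := Nat.lt_two_pow_self (n := m)
    omega
  obtain ⟨enc, henc⟩ := exists_isLinkCode n r m hcard hm0.ne' hr
  obtain ⟨B, hB, hbits, hBD, hBK⟩ := exists_blockProtocol hm0.ne' henc (m * m)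
  have hδ : 0 < (m * m * T + m * κ : ℝ) := by positivity
  have hlen : ∀ a b, a ≠ b → (B.bits a b : ℝ) ≤ (m * m * T + m * κ : ℝ) * G.cap a b := by
    intro a b hab
    have h1 : (B.bits a b : ℝ) ≤ (m * m * n a b + m * Q : ℕ) := by
      rw [hbits, Nat.cast_le]
      exact messageBits_le n r m a b
    have h2 : (n a b : ℝ) ≤ T * G.cap a b := hn a b
    have h3 := hκc a b hab
    push_cast at h1
    have h4 := mul_le_mul_of_nonneg_left h2 (by positivity : (0 : ℝ) ≤ m * m)
    have h5 := mul_le_mul_of_nonneg_left h3 hm0'.le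
    calc (B.bits a b : ℝ) ≤ m * m * n a b + m * Q := h1
      _ ≤ m * m * (T * G.cap a b) + m * (κ * G.cap a b) := add_le_add h4 h5
      _ = (m * m * T + m * κ : ℝ) * G.cap a b := by ring
  have hD : 0 < B.D := by
    rw [hBD]
    positivity
  have hK : 0 < B.K := by
    rw [hBK, rounds]
    positivity
  refine ⟨B.algorithm hδ hlen hD, (B.achieves hδ hlen hD hK hB).mono ?_⟩
  rw [← ENNReal.ofReal_coe_nnreal]
  refine ENNReal.ofReal_le_ofReal (hm.le.trans (le_of_eq ?_))
  rw [hBD, hBK, rounds]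
  push_cast
  rfl

/-- Every throughput below `I*` is achievable. -/
theorem achievable_of_lt {G : Network 4} (hG : G.IsComplete) {R : ℝ≥0∞}
    (hR : R < (G.minTwoIncoming : ℝ≥0∞)) : G.Achievable 1 R := by
  lift R to ℝ≥0 using hR.ne_top
  rw [ENNReal.coe_lt_coe] at hR
  set I := G.minTwoIncoming with hI
  have hgap : 0 < (I : ℝ) - R := sub_pos.2 (by exact_mod_cast hR)
  obtain ⟨T, hT⟩ := exists_nat_gt (2 / ((I : ℝ) - R))
  have hT0 : 0 < (T : ℝ) := lt_trans (by positivity) hT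
  rw [div_lt_iff₀ hgap] at hT
  let n : Fin 4 → Fin 4 → ℕ := fun a b => ⌊(T : ℝ) * G.cap a b⌋₊
  -- Rounding down two links loses less than 2 symbols, and subtracting 1 from the floor absorbs
  -- this. Still `r > T * I - 2 > T * R` by the choice of `T`.
  let r : ℕ := ⌊(T : ℝ) * I⌋₊ - 1
  have hr : ∀ p q a, p ≠ q → p ≠ a → q ≠ a → r ≤ n p a + n q a := by
    intro p q a hpq hpa hqa
    have h1 : (I : ℝ) ≤ G.cap p a + G.cap q a := by
      exact_mod_cast minTwoIncoming_le G hpq hpa hqa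
    have h2 : ⌊(T : ℝ) * I⌋₊ < n p a + n q a + 2 := by
      rw [Nat.floor_lt (by positivity)]
      have := Nat.lt_floor_add_one ((T : ℝ) * G.cap p a)
      have := Nat.lt_floor_add_one ((T : ℝ) * G.cap q a)
      push_cast
      simp only [n]
      nlinarith
    simp only [r]
    omega
  have hrT : (R : ℝ) < r / T := by
    rw [lt_div_iff₀ hT0]
    have h1 := Nat.lt_floor_add_one ((T : ℝ) * I)
    have h2 : (⌊(T : ℝ) * I⌋₊ : ℝ) ≤ r + 1 := by
      exact_mod_cast (by simp only [r]; omega : ⌊(T : ℝ) * I⌋₊ ≤ r + 1)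
    nlinarith
  have hr0 : 0 < r := by
    rcases Nat.eq_zero_or_pos r with h | h
    · rw [h, Nat.cast_zero, zero_div] at hrT
      exact absurd hrT (not_lt.2 R.2)
    · exact h
  exact achievable_of_linkSymbols hG hT0 hr0 (fun a b => Nat.floor_le (by positivity)) hr hrT

end Parameters

end ByzantineConsensus

/-- In a complete 4-node network with at most one Byzantine fault every throughput below `I*`, the
minimum over the nodes of the sum of the capacities of any two incoming links, is achievable,
and the consensus capacity equals `I*`. -/
theorem mainTheorem1 (G : ByzantineConsensus.Network 4) (hG : G.IsComplete) :
    (∀ R : ENNReal, R < (G.minTwoIncoming : ENNReal) → G.Achievable 1 R) ∧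
      G.consensusCapacity 1 = (G.minTwoIncoming : ENNReal) :=
  ⟨fun _ hR => ByzantineConsensus.achievable_of_lt hG hR,
    le_antisymm (sSup_le fun _ hR => ByzantineConsensus.le_minTwoIncoming hR)
      (le_of_forall_lt_imp_le_of_dense fun _ hR =>
        le_sSup (ByzantineConsensus.achievable_of_lt hG hR))⟩
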